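/- Fix a finite relational vocabulary in which the maximal arity of the relation symbols is $2$ (so at least one symbol is binary and none has arity greater than $2$). For $n\ge 1$ let $\mathbf S_n$ be the set of all structures for this vocabulary with universe $[n]=\{1,\dots,n\}$. For a finite structure $\mathcal M$ let $\mathrm{Aut}(\mathcal M)$ be its automorphism group, let $\mathrm{spt}^*(\mathcal M)$ be the number of elements of $\mathcal M$ that are moved by at least one automorphism of $\mathcal M$, and let $\mathbf S_n(\mathrm{spt}^*=m)=\{\mathcal M\in\mathbf S_n:\mathrm{spt}^*(\mathcal M)=m\}$. We say that almost every $\mathcal M\in\mathbf S(\mathrm{spt}^*=m)$ has a property $P$ if $$\lim_{n\to\infty}\frac{|\{\mathcal M\in\mathbf S_n(\mathrm{spt}^*=m):\mathcal M\text{ has }P\}|}{|\mathbf S_n(\mathrm{spt}^*=m)|}=1 .$$ (i) For almost every $\mathcal M\in\mathbf S(\mathrm{spt}^*=3)$, $\mathrm{Aut}(\mathcal M)\cong\mathbb Z_3$ or $\mathrm{Aut}(\mathcal M)\cong \mathrm{Sym}_3$. Moreover, for each $G\in\{\mathbb Z_3,\mathrm{Sym}_3\}$ there is a rational number $0<a_G<1$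 such that $$\lim_{n\to\infty}\frac{|\{\mathcal M\in\mathbf S_n(\mathrm{spt}^*=3):\mathrm{Aut}(\mathcal M)\cong G\}|}{|\mathbf S_n(\mathrm{spt}^*=3)|}=a_G .$$ (ii) Let $i>1$ be an integer. For almost every $\mathcal M\in\mathbf S(\mathrm{spt}^*=2i+1)$ there is $t\in\{1,\dots,i-1\}$ such that $\mathrm{Aut}(\mathcal M)\cong(\mathbb Z_2)^t\times\mathbb Z_3$ or $\mathrm{Aut}(\mathcal M)\cong(\mathbb Z_2)^t\times \mathrm{Sym}_3$. Moreover, for every $t\in\{1,\dots,i-1\}$ and each $G\in\{(\mathbb Z_2)^t\times\mathbb Z_3,\ (\mathbb Z_2)^t\times \mathrm{Sym}_3\}$ there is a rational number $0<a_G<1$ such that $$\lim_{n\to\infty}\frac{|\{\mathcal M\in\mathbf S_n(\mathrm{spt}^*=2i+1):\mathrm{Aut}(\mathcal M)\cong G\}|}{|\mathbf S_n(\mathrm{spt}^*=2i+1)|}=a_G .$$ -/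

import Mathlib

open Filter Topology FirstOrder

universe u v w

namespace TypicalAut

/-- The automorphism group of the structure `S` with universe `A`, as a group of permutations
of `A`: the permutations that are isomorphisms from the structure to itself. -/
def Aut {L : FirstOrder.Language.{u, v}} {A : Type w} (S : L.Structure A) :
    Subgroup (Equiv.Perm A) where
  carrier := {f | ∃ g : A ≃[L] A, g.toEquiv = f}
  mul_mem' := by
    rintro _ _ ⟨g, rfl⟩ ⟨h, rfl⟩
    exact ⟨g.comp h, rfl⟩
  one_mem' := ⟨FirstOrder.Language.Equiv.refl L A, rfl⟩
  inv_mem' := by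
    rintro _ ⟨g, rfl⟩
    exact ⟨g.symm, rfl⟩

/-- The support of a set of permutations of `A`: the elements of `A` that are moved by some member
of the group which these permutations generate. -/
def Spt {A : Type w} (F : Set (Equiv.Perm A)) : Set A :=
  {a | ∃ g ∈ Subgroup.closure F, g a ≠ a}

/-- The support of a structure: the elements that lie in the support of some automorphism. -/
def SptStar {L : FirstOrder.Language.{u, v}} {A : Type w} (S : L.Structure A) : Set A :=
  {a | ∃ f ∈ Aut S, a ∈ Spt {f}}

/-- The number of elements in the support of a structure (used for finite structures). -/
noncomputable def sptStar {L : FirstOrder.Language.{u, v}} {A : Type w} (S : L.Structure A) : ℕ :=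
  (SptStar S).ncard

/-- The set of structures with universe `Fin n` whose support has exactly `m` elements. -/
def structuresSptStarEq (L : FirstOrder.Language.{u, v}) (m n : ℕ) : Set (L.Structure (Fin n)) :=
  {S | sptStar S = m}

/-- The proportion of the members of `K n` (structures with universe `Fin n`) that have the
property `P`. -/
noncomputable def proportion {L : FirstOrder.Language.{u, v}}
    (K : (n : ℕ) → Set (L.Structure (Fin n))) (P : (n : ℕ) → L.Structure (Fin n) → Prop)
    (n : ℕ) : ℝ :=
  ({S ∈ K n | P n S}.ncard : ℝ) / ((K n).ncard : ℝ)

/-- Almost all structures in `⋃ n, K n` have the property `P`. -/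
def AlmostAll {L : FirstOrder.Language.{u, v}}
    (K : (n : ℕ) → Set (L.Structure (Fin n))) (P : (n : ℕ) → L.Structure (Fin n) → Prop) : Prop :=
  Tendsto (proportion K P) atTop (𝓝 1)

/-- The cyclic group of order `m`, written multiplicatively. -/
abbrev Z (m : ℕ) : Type := Multiplicative (ZMod m)

/-- The symmetric group on three elements. -/
abbrev Sym3 : Type := Equiv.Perm (Fin 3)

/-- The automorphism group of `S` is isomorphic, as an abstract group, to `G`. -/
def AutIso {L : FirstOrder.Language.{u, v}} {A : Type w} (S : L.Structure A)
    (G : Type) [Group G] : Prop :=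
  Nonempty (Aut S ≃* G)

/-- Among the members of `K n`, the proportion of structures with automorphism group isomorphic
to `G` converges, as `n → ∞`, to a rational number strictly between `0` and `1`. -/
def HasRationalLimitProportion {L : FirstOrder.Language.{u, v}}
    (K : (n : ℕ) → Set (L.Structure (Fin n))) (G : Type) [Group G] : Prop :=
  ∃ a : ℚ, 0 < a ∧ a < 1 ∧ Tendsto (proportion K fun _ S => AutIso S G) atTop (𝓝 (a : ℝ))

end TypicalAut

/-! A structure of arity at most 2 is a colouring: one colour for the 0-ary symbols, one for each
point, one for each ordered pair. Structures with m moved points are counted by the orbit partition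
of their automorphism group, whose nontrivial classes cover exactly m points.

Split the universe into a support X with partition s, all of whose classes are nontrivial, and N
further points Y forming singletons. If the block-preserving automorphisms are transitive on every
class, then the colour between a point of X and a point of Y depends only on the class. Such
colourings are therefore exactly the gluings of a full colouring of X with free remaining data
(`exists_glue_of_full`), and their number is a constant times |C₁|^N |C₂|^(N² + 2qN), where q is the
number of classes (`fullCount_ext`). Almost all of them have no further automorphisms: a union bound
over all permutations that break the blocks shows this (`errCount_le`).

More classes win exponentially. With m = 2k + 3 and all classes of size at least 2, there are at
most k + 1 classes, with equality exactly for k pairs and one triple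
(`card_quotient_le_or_exists_blocks`). The other partitions number only polynomially many in N, and
each loses a factor of at least 2^N. Hence the limiting proportion of an isomorphism-invariant
property is a ratio of two counts of full colourings of k pairs and a triple
(`tendsto_movedCount_div`), a rational number.

It remains to find the groups on these blocks. Fullness forces the rotation of the triple to be an
automorphism, so colours between pairs and triple ignore the point of the triple and the group
splits as H₁ × H₂. Here H₁ is an elementary abelian 2-group of rank t ≤ k, with t ≥ 1 if k ≥ 1, and
H₂ contains a 3-cycle (`exists_mulEquiv_of_full`). Every such t occurs with both choices of H₂, by
linking pairs so that they must be swapped together (`exists_full_mulEquiv`). -/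

namespace TypicalAut

/-- A structure with unary and binary relations, given by the colours of points and of pairs. -/
abbrev Colouring (C₀ : Type*) (C₁ : Type*) (C₂ : Type*) (A : Type*) :=
  C₀ × (A → C₁) × (A → A → C₂)

/-! ### Orbit partitions, full colourings and gluing -/

section Colouring

variable {C₀ C₁ C₂ : Type*} {A B X Y : Type}

/-- The automorphism group of a colouring. -/
def autC (M : Colouring C₀ C₁ C₂ A) : Subgroup (Equiv.Perm A) where
  carrier := {g | (∀ x, M.2.1 (g x) = M.2.1 x) ∧ ∀ x y, M.2.2 (g x) (g y) = M.2.2 x y}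
  mul_mem' := by
    rintro a b ⟨ha, ha'⟩ ⟨hb, hb'⟩
    exact ⟨fun x => by simp [ha, hb], fun x y => by simp [ha', hb']⟩
  one_mem' := by simp
  inv_mem' := by
    rintro a ⟨ha, ha'⟩
    refine ⟨fun x => ?_, fun x y => ?_⟩
    · rw [← ha]; simp
    · rw [← ha']; simp

theorem mem_autC {M : Colouring C₀ C₁ C₂ A} {g : Equiv.Perm A} :
    g ∈ autC M ↔ (∀ x, M.2.1 (g x) = M.2.1 x) ∧ ∀ x y, M.2.2 (g x) (g y) = M.2.2 x y :=
  Iff.rfl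

/-- The partition into orbits. -/
def orb (H : Subgroup (Equiv.Perm A)) : Setoid A where
  r x y := ∃ g ∈ H, g x = y
  iseqv :=
    { refl := fun x => ⟨1, H.one_mem, rfl⟩
      symm := by
        rintro x _ ⟨g, hg, rfl⟩
        exact ⟨g⁻¹, H.inv_mem hg, by simp⟩
      trans := by
        rintro x _ _ ⟨g, hg, rfl⟩ ⟨h, hh, rfl⟩
        exact ⟨h * g, H.mul_mem hh hg, rfl⟩ }

/-- The permutations that map every class of a partition onto itself. -/
def blockStab (r : Setoid A) : Subgroup (Equiv.Perm A) where
  carrier := {g | ∀ x, r x (g x)}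
  mul_mem' := fun {a b} ha hb x => r.trans (hb x) (ha (b x))
  one_mem' := fun x => r.refl x
  inv_mem' := fun {a} ha x => by
    have := ha (a⁻¹ x)
    rw [← Equiv.Perm.mul_apply, mul_inv_cancel, Equiv.Perm.one_apply] at this
    exact r.symm this

theorem mem_blockStab {r : Setoid A} {g : Equiv.Perm A} : g ∈ blockStab r ↔ ∀ x, r x (g x) :=
  Iff.rfl

/-- The block-preserving automorphisms act transitively on each class. -/
def Full (r : Setoid A) (M : Colouring C₀ C₁ C₂ A) : Prop :=
  ∀ x y, r x y → ∃ g ∈ autC M ⊓ blockStab r, g x = y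

/-- Separates a condition that factors exactly under gluing (`Full`) from one that fails only rarely
(no automorphism breaks the blocks). -/
theorem orb_autC_eq_iff {r : Setoid A} {M : Colouring C₀ C₁ C₂ A} :
    orb (autC M) = r ↔ Full r M ∧ autC M ≤ blockStab r := by
  constructor
  · rintro rfl
    have h : autC M ≤ blockStab (orb (autC M)) := fun g hg x => ⟨g, hg, rfl⟩
    refine ⟨?_, h⟩
    rintro x y ⟨g, hg, rfl⟩
    exact ⟨g, ⟨hg, h hg⟩, rfl⟩
  · rintro ⟨h, h'⟩
    ext x y
    constructor
    · rintro ⟨g, hg, rfl⟩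
      exact h' hg x
    · intro hxy
      obtain ⟨g, hg, rfl⟩ := h x y hxy
      exact ⟨g, hg.1, rfl⟩

/-- The extension of a partition by singletons. -/
def ext (s : Setoid X) (Y : Type) : Setoid (X ⊕ Y) :=
  Setoid.ker (Sum.map (Quotient.mk s) (id : Y → Y))

@[simp] theorem ext_inl_inl {s : Setoid X} {x x' : X} :
    ext s Y (.inl x) (.inl x') ↔ s x x' := by
  refine (Sum.inl_injective.eq_iff (a := (⟦x⟧ : Quotient s))).trans ?_
  exact Quotient.eq

@[simp] theorem ext_inr_inr {s : Setoid X} {y y' : Y} :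
    ext s Y (.inr y) (.inr y') ↔ y = y' :=
  Sum.inr_injective.eq_iff

@[simp] theorem ext_inl_inr {s : Setoid X} {x : X} {y : Y} :
    ¬ ext s Y (.inl x) (.inr y) :=
  Sum.inl_ne_inr

@[simp] theorem ext_inr_inl {s : Setoid X} {x : X} {y : Y} :
    ¬ ext s Y (.inr y) (.inl x) :=
  Sum.inr_ne_inl

/-- The colours outside the support `X`, when these depend only on classes. -/
abbrev Rest (C₁ C₂ : Type*) (Q Y : Type) :=
  (Y → C₁) × (Y → Y → C₂) × (Q → Y → C₂) × (Y → Q → C₂)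

/-- The colouring of `X ⊕ Y` built from a colouring of `X` and the remaining colours. -/
def glue (s : Setoid X) (p : Colouring C₀ C₁ C₂ X × Rest C₁ C₂ (Quotient s) Y) :
    Colouring C₀ C₁ C₂ (X ⊕ Y) :=
  (p.1.1, Sum.elim p.1.2.1 p.2.1, fun a b =>
    match a, b with
    | .inl x, .inl x' => p.1.2.2 x x'
    | .inr y, .inr y' => p.2.2.1 y y'
    | .inl x, .inr y => p.2.2.2.1 ⟦x⟧ y
    | .inr y, .inl x => p.2.2.2.2 y ⟦x⟧)

theorem glue_injective (s : Setoid X) :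
    Function.Injective (glue (C₀ := C₀) (C₁ := C₁) (C₂ := C₂) (Y := Y) s) := by
  rintro ⟨⟨a, b, c⟩, d, e, f, g⟩ ⟨⟨a', b', c'⟩, d', e', f', g'⟩ h
  simp only [glue, Prod.mk.injEq] at h
  obtain ⟨rfl, h1, h2⟩ := h
  have h2' := fun a b => congrFun (congrFun h2 a) b
  have hb : b = b' := funext fun x => congrFun h1 (.inl x)
  have hd : d = d' := funext fun x => congrFun h1 (.inr x)
  have hc : c = c' := funext fun x => funext fun y => h2' (.inl x) (.inl y)
  have he : e = e' := funext fun x => funext fun y => h2' (.inr x) (.inr y)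
  have hf : f = f' := funext fun q => funext fun y => by
    induction q using Quotient.inductionOn with
    | h x => exact h2' (.inl x) (.inr y)
  have hg : g = g' := funext fun y => funext fun q => by
    induction q using Quotient.inductionOn with
    | h x => exact h2' (.inr y) (.inl x)
  subst hb hc hd he hf hg
  rfl

/-- Extending a permutation of `X` by the identity. -/
def extPerm (X Y : Type) : Equiv.Perm X →* Equiv.Perm (X ⊕ Y) where
  toFun h := Equiv.sumCongr h 1
  map_one' := by ext (x | x) <;> rfl
  map_mul' a b := by ext (x | x) <;> rfl

theorem extPerm_injective : Function.Injective (extPerm X Y) := by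
  intro a b h
  ext x
  have := Equiv.congr_fun h (.inl x)
  simpa [extPerm] using this

@[simp] theorem extPerm_inl (h : Equiv.Perm X) (x : X) :
    extPerm X Y h (.inl x) = .inl (h x) := rfl

@[simp] theorem extPerm_inr (h : Equiv.Perm X) (y : Y) :
    extPerm X Y h (.inr y) = .inr y := rfl

/-- Every point of Y is a class by itself, hence fixed, so all the action takes place on X. -/
theorem exists_extPerm_of_mem_blockStab {s : Setoid X} {g : Equiv.Perm (X ⊕ Y)}
    (hg : g ∈ blockStab (ext s Y)) : ∃ h ∈ blockStab s, extPerm X Y h = g := by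
  have hY : ∀ y, g (.inr y) = .inr y := by
    intro y
    have := hg (.inr y)
    rcases hgy : g (.inr y) with x | y'
    · simp [hgy] at this
    · simp only [hgy, ext_inr_inr] at this
      rw [this]
  have hX : ∀ g ∈ blockStab (ext s Y), ∀ x, ∃ x', g (.inl x) = .inl x' ∧ s x x' := by
    intro g hg x
    have := hg (.inl x)
    rcases hgx : g (.inl x) with x' | y'
    · simp only [hgx, ext_inl_inl] at this
      exact ⟨x', rfl, this⟩
    · simp [hgx] at this
  choose f hf hfs using hX g hg
  choose f' hf' hfs' using hX g⁻¹ (inv_mem hg)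
  refine ⟨⟨f, f', fun x => ?_, fun x => ?_⟩, hfs, ?_⟩
  · apply Sum.inl_injective (β := Y)
    rw [← hf', ← hf]; simp
  · apply Sum.inl_injective (β := Y)
    rw [← hf, ← hf']; simp
  · ext (x | y)
    · simp [hf]
    · simp [hY]

theorem extPerm_mem_autC_glue {s : Setoid X} {h : Equiv.Perm X} (hs : h ∈ blockStab s)
    (p : Colouring C₀ C₁ C₂ X × Rest C₁ C₂ (Quotient s) Y) :
    extPerm X Y h ∈ autC (glue s p) ↔ h ∈ autC p.1 := by
  have hq : ∀ x, (⟦h x⟧ : Quotient s) = ⟦x⟧ := fun x => Quotient.sound (s.symm (hs x))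
  simp [mem_autC, glue, hq]

theorem map_extPerm (s : Setoid X) (p : Colouring C₀ C₁ C₂ X × Rest C₁ C₂ (Quotient s) Y) :
    (autC p.1 ⊓ blockStab s).map (extPerm X Y) = autC (glue s p) ⊓ blockStab (ext s Y) := by
  ext g
  constructor
  · rintro ⟨h, ⟨h1, h2⟩, rfl⟩
    refine ⟨(extPerm_mem_autC_glue h2 p).2 h1, ?_⟩
    rintro (x | y)
    · simpa using h2 x
    · simp
  · rintro ⟨h1, h2⟩
    obtain ⟨h, hs, rfl⟩ := exists_extPerm_of_mem_blockStab h2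
    exact ⟨h, ⟨(extPerm_mem_autC_glue hs p).1 h1, hs⟩, rfl⟩

/-- Block-preserving automorphisms of a glued colouring are those of the colouring of `X`. -/
noncomputable def blockAutEquiv (s : Setoid X)
    (p : Colouring C₀ C₁ C₂ X × Rest C₁ C₂ (Quotient s) Y) :
    (autC p.1 ⊓ blockStab s : Subgroup _) ≃*
      (autC (glue s p) ⊓ blockStab (ext s Y) : Subgroup _) :=
  (Subgroup.equivMapOfInjective _ _ extPerm_injective).trans
    (MulEquiv.subgroupCongr (map_extPerm s p))

theorem full_glue_iff {s : Setoid X} {p : Colouring C₀ C₁ C₂ X × Rest C₁ C₂ (Quotient s) Y} :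
    Full (ext s Y) (glue s p) ↔ Full s p.1 := by
  unfold Full
  rw [← map_extPerm]
  constructor
  · intro H x y hxy
    obtain ⟨_, ⟨h, hh, rfl⟩, e⟩ := H (.inl x) (.inl y) (by simpa using hxy)
    exact ⟨h, hh, by simpa using e⟩
  · rintro H (x | x) (y | y) hxy
    · obtain ⟨h, hh, rfl⟩ := H x y (by simpa using hxy)
      exact ⟨_, ⟨h, hh, rfl⟩, rfl⟩
    · simp at hxy
    · simp at hxy
    · simp only [ext_inr_inr] at hxy
      subst hxy
      exact ⟨1, Subgroup.one_mem _, rfl⟩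

/-- A block-preserving automorphism taking x to x' fixes every y in Y, so x and x' have the same
colours towards y, in both directions. -/
theorem exists_glue_of_full {s : Setoid X} {M : Colouring C₀ C₁ C₂ (X ⊕ Y)}
    (hM : Full (ext s Y) M) :
    ∃ p : Colouring C₀ C₁ C₂ X × Rest C₁ C₂ (Quotient s) Y, glue s p = M := by
  have key : ∀ x x' : X, s x x' → ∀ y : Y,
      M.2.2 (.inl x) (.inr y) = M.2.2 (.inl x') (.inr y) ∧
      M.2.2 (.inr y) (.inl x) = M.2.2 (.inr y) (.inl x') := by
    intro x x' hx y
    obtain ⟨g, ⟨hg, hs⟩, e⟩ := hM (.inl x) (.inl x') (by simpa using hx)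
    obtain ⟨h, -, rfl⟩ := exists_extPerm_of_mem_blockStab hs
    rw [← e]
    have h1 := hg.2 (.inl x) (.inr y)
    have h2 := hg.2 (.inr y) (.inl x)
    simp only [extPerm_inr] at h1 h2
    exact ⟨h1.symm, h2.symm⟩
  refine ⟨⟨⟨M.1, fun x => M.2.1 (.inl x), fun x y => M.2.2 (.inl x) (.inl y)⟩,
    fun y => M.2.1 (.inr y), fun x y => M.2.2 (.inr x) (.inr y),
    fun q y => q.lift (fun x => M.2.2 (.inl x) (.inr y)) (fun a b h => (key a b h y).1),
    fun y q => q.lift (fun x => M.2.2 (.inr y) (.inl x)) (fun a b h => (key a b h y).2)⟩, ?_⟩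
  refine Prod.ext rfl (Prod.ext ?_ ?_)
  · ext (x | x) <;> rfl
  · ext (x | x) (y | y) <;> rfl

end Colouring

/-- An isomorphism-invariant property of groups. -/
def IsoInvariant (P : (G : Type) → [Group G] → Prop) : Prop :=
  ∀ (G H : Type) [Group G] [Group H], Nonempty (G ≃* H) → P G → P H

theorem IsoInvariant.iff {P : (G : Type) → [Group G] → Prop} (hP : IsoInvariant P)
    {G H : Type} [Group G] [Group H] (e : G ≃* H) : P G ↔ P H :=
  ⟨hP G H ⟨e⟩, hP H G ⟨e.symm⟩⟩

/-! ### Factorisation of the counts -/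

section Count

variable (C₀ C₁ C₂ : Type*) {A B X Y : Type}

/-- The number of full colourings whose block-preserving automorphism group has property `P`. -/
noncomputable def fullCount (s : Setoid X) (P : (G : Type) → [Group G] → Prop) : ℕ :=
  Nat.card {M : Colouring C₀ C₁ C₂ X // Full s M ∧ P (autC M ⊓ blockStab s : Subgroup _)}

theorem fullCount_ext (s : Setoid X) {P : (G : Type) → [Group G] → Prop} (hP : IsoInvariant P) :
    fullCount C₀ C₁ C₂ (ext s Y) P =
      fullCount C₀ C₁ C₂ s P * Nat.card (Rest C₁ C₂ (Quotient s) Y) := by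
  unfold fullCount
  rw [← Nat.card_prod]
  symm
  refine Nat.card_congr (Equiv.ofBijective
    (fun q => ⟨glue s (q.1.1, q.2), full_glue_iff.2 q.1.2.1,
      (hP.iff (blockAutEquiv s (q.1.1, q.2))).1 q.1.2.2⟩) ⟨?_, ?_⟩)
  · rintro ⟨⟨a, ha⟩, b⟩ ⟨⟨a', ha'⟩, b'⟩ h
    have := glue_injective s (Subtype.ext_iff.1 h)
    simp only [Prod.mk.injEq] at this
    simp [this]
  · rintro ⟨M, hM, hPM⟩
    obtain ⟨p, rfl⟩ := exists_glue_of_full hM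
    exact ⟨⟨⟨p.1, full_glue_iff.1 hM, (hP.iff (blockAutEquiv s p)).2 hPM⟩, p.2⟩, rfl⟩

/-- The number of colourings whose automorphism group has property `P` and orbit partition `r`. -/
noncomputable def orbCount (r : Setoid A) (P : (G : Type) → [Group G] → Prop) : ℕ :=
  Nat.card {M : Colouring C₀ C₁ C₂ A // orb (autC M) = r ∧ P (autC M)}

theorem orbCount_le_fullCount [Finite C₀] [Finite C₁] [Finite C₂] [Finite A]
    (r : Setoid A) {P : (G : Type) → [Group G] → Prop} (hP : IsoInvariant P) :
    orbCount C₀ C₁ C₂ r P ≤ fullCount C₀ C₁ C₂ r P := by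
  refine Nat.card_le_card_of_injective (fun M => ⟨M.1, ?_, ?_⟩) ?_
  · exact (orb_autC_eq_iff.1 M.2.1).1
  · have h := (orb_autC_eq_iff.1 M.2.1).2
    exact (hP.iff (MulEquiv.subgroupCongr (inf_eq_left.2 h))).2 M.2.2
  · intro a b h
    simpa [Subtype.ext_iff] using h

/-- The number of choices of colours for which the glued colouring has an automorphism that does
not preserve the blocks. -/
noncomputable def errCount (s : Setoid X) (Y : Type) : ℕ :=
  Nat.card {p : Colouring C₀ C₁ C₂ X × Rest C₁ C₂ (Quotient s) Y //
    ¬ autC (glue s p) ≤ blockStab (ext s Y)}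

/-- A full colouring either has the prescribed orbit partition or has an automorphism breaking the
blocks; together with `orbCount_le_fullCount` this traps the orbit count. -/
theorem fullCount_le_orbCount_add [Finite C₀] [Finite C₁] [Finite C₂] [Finite X] [Finite Y]
    (s : Setoid X) {P : (G : Type) → [Group G] → Prop} (hP : IsoInvariant P) :
    fullCount C₀ C₁ C₂ (ext s Y) P ≤
      orbCount C₀ C₁ C₂ (ext s Y) P + errCount C₀ C₁ C₂ s Y := by
  classical
  unfold fullCount orbCount errCount
  rw [← Nat.card_sum]
  have hg : ∀ M : {M : Colouring C₀ C₁ C₂ (X ⊕ Y) // Full (ext s Y) M ∧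
      P (autC M ⊓ blockStab (ext s Y) : Subgroup _)}, ∃ p, glue s p = M.1 :=
    fun M => exists_glue_of_full M.2.1
  choose f hf using hg
  refine Nat.card_le_card_of_injective (fun M =>
    if h : autC M.1 ≤ blockStab (ext s Y) then
      .inl ⟨M.1, orb_autC_eq_iff.2 ⟨M.2.1, h⟩,
        (hP.iff (MulEquiv.subgroupCongr (inf_eq_left.2 h))).1 M.2.2⟩
    else .inr ⟨f M, by rwa [hf]⟩) ?_
  intro M M' h
  simp only at h
  split_ifs at h with h1 h2 h2
  · simpa [Subtype.ext_iff] using h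
  · simp only [Sum.inr.injEq, Subtype.mk.injEq] at h
    rw [Subtype.ext_iff, ← hf M, ← hf M', h]

end Count

/-! ### Union bound over block-breaking permutations -/

section UnionBound

variable {C₀ C₁ C₂ : Type*} {A X Y : Type}

/-- Take D of maximal size among the sets disjoint from their image. A moved y outside D, its image
and its preimage could be added to D. -/
theorem exists_maximal_displaced [Fintype Y] [DecidableEq Y] (g : Equiv.Perm (X ⊕ Y)) :
    ∃ D : Finset Y, (∀ d ∈ D, ∀ d' ∈ D, g (.inr d) ≠ .inr d') ∧
      ∀ y, g (.inr y) ≠ .inr y →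
        y ∈ D ∨ (∃ d ∈ D, g (.inr d) = .inr y) ∨ ∃ d ∈ D, g (.inr y) = .inr d := by
  classical
  let P : Finset (Finset Y) :=
    Finset.univ.filter fun D => ∀ d ∈ D, ∀ d' ∈ D, g (.inr d) ≠ .inr d'
  obtain ⟨D, hD, hmax⟩ := P.exists_max_image Finset.card ⟨∅, by simp [P]⟩
  simp only [P, Finset.mem_filter, Finset.mem_univ, true_and] at hD hmax
  refine ⟨D, hD, fun y hy => ?_⟩
  by_contra! hcon
  obtain ⟨h1, h2, h3⟩ := hcon
  have := hmax (insert y D) (by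
    intro d hd d' hd'
    rw [Finset.mem_insert] at hd hd'
    rcases hd with rfl | hd <;> rcases hd' with rfl | hd'
    · exact hy
    · exact h3 d' hd'
    · exact h2 d hd
    · exact hD d hd d' hd')
  rw [Finset.card_insert_of_notMem h1] at this
  omega

theorem card_support_le [Fintype X] [Fintype Y] [DecidableEq X] [DecidableEq Y]
    {g : Equiv.Perm (X ⊕ Y)} {D : Finset Y}
    (hD : ∀ y, g (.inr y) ≠ .inr y →
        y ∈ D ∨ (∃ d ∈ D, g (.inr d) = .inr y) ∨ ∃ d ∈ D, g (.inr y) = .inr d) :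
    g.support.card ≤ Fintype.card X + 3 * D.card := by
  have hsub : g.support ⊆ Finset.univ.image Sum.inl ∪ (D.image Sum.inr ∪
      ((D.image Sum.inr).image g ∪ (D.image Sum.inr).image ⇑g⁻¹)) := by
    rintro (x | y) hx
    · simp
    · rw [Equiv.Perm.mem_support] at hx
      simp only [Finset.mem_union, Finset.mem_image, exists_exists_and_eq_and]
      rcases hD y hx with h | h | ⟨d, hd, h⟩
      · exact .inr (.inl ⟨y, h, rfl⟩)
      · exact .inr (.inr (.inl h))
      · exact .inr (.inr (.inr ⟨d, hd, by rw [← h]; simp⟩))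
  refine (Finset.card_le_card hsub).trans ?_
  refine (Finset.card_union_le _ _).trans (add_le_add Finset.card_image_le ?_)
  have h0 : (D.image (Sum.inr : Y → X ⊕ Y)).card ≤ D.card := Finset.card_image_le
  have h1 := Finset.card_union_le (D.image (Sum.inr : Y → X ⊕ Y))
    ((D.image Sum.inr).image g ∪ (D.image Sum.inr).image ⇑g⁻¹)
  have h2 := Finset.card_union_le ((D.image (Sum.inr : Y → X ⊕ Y)).image g)
    ((D.image Sum.inr).image ⇑g⁻¹)
  have h3 : ((D.image (Sum.inr : Y → X ⊕ Y)).image g).card ≤ _ := Finset.card_image_le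
  have h4 : ((D.image (Sum.inr : Y → X ⊕ Y)).image ⇑g⁻¹).card ≤ _ := Finset.card_image_le
  omega

theorem card_fun_compl_mul_le {I : Type} [Finite I] [Finite Y] [Finite C₂]
    (hC : 2 ≤ Nat.card C₂) (D : Finset I) :
    Nat.card ({i // i ∉ D} → Y → C₂) * 2 ^ (D.card * Nat.card Y) ≤ Nat.card (I → Y → C₂) := by
  classical
  rw [Nat.card_congr (Equiv.piEquivPiSubtypeProd (· ∈ D) (fun _ : I => Y → C₂)),
    Nat.card_prod, mul_comm]
  refine Nat.mul_le_mul_right _ ?_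
  have hcard : Nat.card {i // i ∈ D} = D.card := by simp
  rw [Nat.card_fun, Nat.card_fun, hcard, ← pow_mul, mul_comm]
  exact Nat.pow_le_pow_left hC _

/-- Invariance under g reads the row of each d in D off the row of g d, which lies outside D. The
|D| · |Y| entries in these rows are thus redundant. -/
theorem card_fixed_mul_le_of_displaced [Finite C₀] [Finite C₁] [Finite C₂] [Finite X] [Finite Y]
    (hC : 2 ≤ Nat.card C₂) (s : Setoid X) {g : Equiv.Perm (X ⊕ Y)} {D : Finset Y}
    (hD : ∀ d ∈ D, ∀ d' ∈ D, g (.inr d) ≠ .inr d') :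
    Nat.card {p : Colouring C₀ C₁ C₂ X × Rest C₁ C₂ (Quotient s) Y // g ∈ autC (glue s p)} *
        2 ^ (D.card * Nat.card Y) ≤
      Nat.card (Colouring C₀ C₁ C₂ X × Rest C₁ C₂ (Quotient s) Y) := by
  let T := Colouring C₀ C₁ C₂ X × (Y → C₁) × ({y // y ∉ D} → Y → C₂) ×
    (Quotient s → Y → C₂) × (Y → Quotient s → C₂)
  have h1 : Nat.card {p : Colouring C₀ C₁ C₂ X × Rest C₁ C₂ (Quotient s) Y //
      g ∈ autC (glue s p)} ≤ Nat.card T := by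
    refine Nat.card_le_card_of_injective
      (fun p => ⟨p.1.1, p.1.2.1, fun y => p.1.2.2.1 y, p.1.2.2.2⟩) ?_
    rintro ⟨⟨N, a, b, c⟩, hp⟩ ⟨⟨N', a', b', c'⟩, hp'⟩ h
    obtain ⟨rfl, h⟩ := Prod.mk.inj h
    obtain ⟨rfl, h⟩ := Prod.mk.inj h
    obtain ⟨hb, rfl⟩ := Prod.mk.inj h
    simp only [Subtype.mk.injEq, Prod.mk.injEq, true_and, and_true]
    ext d y
    by_cases hd : d ∈ D
    · have e1 := hp.2 (.inr d) (.inr y)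
      have e2 := hp'.2 (.inr d) (.inr y)
      change _ = b d y at e1
      change _ = b' d y at e2
      rw [← e1, ← e2]
      -- If g sends d into X, the colour is among the retained data; otherwise it stands in the row
      -- of some z outside D.
      rcases hgd : g (.inr d) with x | z
      · rcases g (.inr y) with x' | y' <;> rfl
      · have hz : z ∉ D := fun hz => hD d hd z hz hgd
        rcases g (.inr y) with x' | y'
        · rfl
        · exact congrFun (congrFun hb ⟨z, hz⟩) y'
    · exact congrFun (congrFun hb ⟨d, hd⟩) y
  refine (Nat.mul_le_mul_right _ h1).trans ?_
  have h2 := card_fun_compl_mul_le (Y := Y) hC D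
  simp only [T, Nat.card_prod]
  calc _ = Nat.card C₀ * (Nat.card (X → C₁) * Nat.card (X → X → C₂)) *
        (Nat.card (Y → C₁) * ((Nat.card ({i // i ∉ D} → Y → C₂) * 2 ^ (D.card * Nat.card Y)) *
        (Nat.card (Quotient s → Y → C₂) * Nat.card (Y → Quotient s → C₂)))) := by ring
    _ ≤ _ := by gcongr

/-- Here g fixes Y pointwise but joins two classes, which makes the colours from the class of x to Y
a copy of those from the class of x'. -/
theorem card_fixed_mul_le_of_merge [Finite C₀] [Finite C₁] [Finite C₂] [Finite X] [Finite Y]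
    (hC : 2 ≤ Nat.card C₂) (s : Setoid X) {g : Equiv.Perm (X ⊕ Y)}
    (hY : ∀ y, g (.inr y) = .inr y) {x x' : X} (hx : g (.inl x) = .inl x') (hs : ¬ s x x') :
    Nat.card {p : Colouring C₀ C₁ C₂ X × Rest C₁ C₂ (Quotient s) Y // g ∈ autC (glue s p)} *
        2 ^ (1 * Nat.card Y) ≤
      Nat.card (Colouring C₀ C₁ C₂ X × Rest C₁ C₂ (Quotient s) Y) := by
  let D : Finset (Quotient s) := {⟦x⟧}
  let T := Colouring C₀ C₁ C₂ X × (Y → C₁) × (Y → Y → C₂) ×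
    ({q // q ∉ D} → Y → C₂) × (Y → Quotient s → C₂)
  have h1 : Nat.card {p : Colouring C₀ C₁ C₂ X × Rest C₁ C₂ (Quotient s) Y //
      g ∈ autC (glue s p)} ≤ Nat.card T := by
    refine Nat.card_le_card_of_injective
      (fun p => ⟨p.1.1, p.1.2.1, p.1.2.2.1, fun q => p.1.2.2.2.1 q, p.1.2.2.2.2⟩) ?_
    rintro ⟨⟨N, a, c, b, d⟩, hp⟩ ⟨⟨N', a', c', b', d'⟩, hp'⟩ h
    obtain ⟨rfl, h⟩ := Prod.mk.inj h
    obtain ⟨rfl, h⟩ := Prod.mk.inj h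
    obtain ⟨rfl, h⟩ := Prod.mk.inj h
    obtain ⟨hb, rfl⟩ := Prod.mk.inj h
    simp only [Subtype.mk.injEq, Prod.mk.injEq, true_and, and_true]
    ext q y
    by_cases hq : q ∈ D
    · have hx' : (⟦x'⟧ : Quotient s) ∉ D := by
        simp only [D, Finset.mem_singleton]
        exact fun h => hs (s.symm (Quotient.exact h))
      simp only [D, Finset.mem_singleton] at hq
      subst hq
      have e1 := hp.2 (.inl x) (.inr y)
      have e2 := hp'.2 (.inl x) (.inr y)
      rw [hx, hY] at e1 e2
      change b _ y = b _ y at e1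
      change b' _ y = b' _ y at e2
      rw [← e1, ← e2]
      exact congrFun (congrFun hb ⟨_, hx'⟩) y
    · exact congrFun (congrFun hb ⟨q, hq⟩) y
  refine (Nat.mul_le_mul_right _ h1).trans ?_
  have h2 := card_fun_compl_mul_le (Y := Y) hC D
  rw [show D.card = 1 from Finset.card_singleton _] at h2
  simp only [T, Nat.card_prod]
  calc _ = Nat.card C₀ * (Nat.card (X → C₁) * Nat.card (X → X → C₂)) *
        (Nat.card (Y → C₁) * (Nat.card (Y → Y → C₂) *
        ((Nat.card ({i // i ∉ D} → Y → C₂) * 2 ^ (1 * Nat.card Y)) *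
          Nat.card (Y → Quotient s → C₂)))) := by ring
    _ ≤ _ := by gcongr

/-- Merges the two cases into one parameter d: the saving is 2^(d|Y|), and d is large enough to pay
for the whole support of g. The merging case has d = 1 and support inside X. -/
theorem card_fixed_mul_le [Finite C₀] [Finite C₁] [Finite C₂] [Fintype X] [Fintype Y]
    [DecidableEq X] [DecidableEq Y]
    (hC : 2 ≤ Nat.card C₂) (s : Setoid X) {g : Equiv.Perm (X ⊕ Y)}
    (hg : g ∉ blockStab (ext s Y)) :
    ∃ d : ℕ, g.support.card ≤ (Fintype.card X + 3) * d ∧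
      Nat.card {p : Colouring C₀ C₁ C₂ X × Rest C₁ C₂ (Quotient s) Y // g ∈ autC (glue s p)} *
        2 ^ (d * Nat.card Y) ≤
      Nat.card (Colouring C₀ C₁ C₂ X × Rest C₁ C₂ (Quotient s) Y) := by
  by_cases hY : ∀ y, g (.inr y) = .inr y
  · simp only [mem_blockStab, not_forall] at hg
    obtain ⟨a, ha⟩ := hg
    rcases a with x | y
    · rcases hgx : g (.inl x) with x' | y
      · refine ⟨1, ?_, card_fixed_mul_le_of_merge hC s hY hgx (by simpa [hgx] using ha)⟩
        have := card_support_le (g := g) (D := ∅) (by simp [hY])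
        simp at this
        omega
      · have := g.injective (hgx.trans (hY y).symm)
        simp at this
    · simp [hY] at ha
  · obtain ⟨D, hD, hD'⟩ := exists_maximal_displaced g
    refine ⟨D.card, ?_, card_fixed_mul_le_of_displaced hC s hD⟩
    have h1 := card_support_le hD'
    have h2 : 0 < D.card := by
      rw [Finset.card_pos]
      push Not at hY
      obtain ⟨y, hy⟩ := hY
      rcases hD' y hy with h | ⟨d, hd, -⟩ | ⟨d, hd, -⟩
      exacts [⟨_, h⟩, ⟨_, hd⟩, ⟨_, hd⟩]
    -- As |D| ≥ 1, the bound |X| + 3|D| is at most (|X| + 3)|D|.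
    nlinarith

/-- Enlarging the sum from permutations to all maps turns it into a product over points, each factor
being at most 1 + |A|ρ ≤ exp(|A|ρ). -/
theorem sum_perm_pow_support_le [Fintype A] [DecidableEq A] {ρ : ℝ} (hρ : 0 ≤ ρ) :
    ∑ g : Equiv.Perm A, ρ ^ g.support.card ≤ Real.exp ((Fintype.card A : ℝ) ^ 2 * ρ) := by
  let w : A → A → ℝ := fun a b => if b = a then 1 else ρ
  have hw : ∀ a b, 0 ≤ w a b := fun a b => by
    simp only [w]; split_ifs <;> simp [hρ]
  have h1 : ∀ g : Equiv.Perm A, ρ ^ g.support.card = ∏ a, w a (g a) := by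
    intro g
    simp only [w]
    rw [Finset.prod_ite]
    simp [Equiv.Perm.support]
  calc ∑ g : Equiv.Perm A, ρ ^ g.support.card
      = ∑ g : Equiv.Perm A, ∏ a, w a (g a) := Finset.sum_congr rfl fun g _ => h1 g
    _ = ∑ f ∈ Finset.univ.image (fun g : Equiv.Perm A => (g : A → A)), ∏ a, w a (f a) := by
        rw [Finset.sum_image]
        exact fun a _ b _ h => DFunLike.coe_injective h
    _ ≤ ∑ f : A → A, ∏ a, w a (f a) :=
        Finset.sum_le_sum_of_subset_of_nonneg (Finset.subset_univ _)
          fun f _ _ => Finset.prod_nonneg fun a _ => hw a _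
    _ = ∏ a, ∑ b, w a b := by rw [Finset.prod_univ_sum, Fintype.piFinset_univ]
    _ ≤ ∏ _a : A, Real.exp (Fintype.card A * ρ) := by
        refine Finset.prod_le_prod (fun a _ => Finset.sum_nonneg fun b _ => hw a b) fun a _ => ?_
        have : ∑ b, w a b ≤ ∑ b, ((if b = a then 1 else 0) + ρ) :=
          Finset.sum_le_sum fun b _ => by simp only [w]; split_ifs <;> simp [hρ]
        refine this.trans ?_
        rw [Finset.sum_add_distrib]
        simp only [Finset.sum_ite_eq', Finset.mem_univ, if_true, Finset.sum_const,
          Finset.card_univ, nsmul_eq_mul]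
        linarith [Real.add_one_le_exp (Fintype.card A * ρ)]
    _ = _ := by
        rw [Finset.prod_const, ← Real.exp_nat_mul, Finset.card_univ]
        congr 1
        ring

/-- The decay rate in the union bound. -/
noncomputable def decay (m N : ℕ) : ℝ := (2 : ℝ) ^ (-(N : ℝ) / (m + 3))

theorem errCount_le [Finite C₀] [Finite C₁] [Finite C₂] [Fintype X] [Fintype Y]
    (hC : 2 ≤ Nat.card C₂) (s : Setoid X) :
    (errCount C₀ C₁ C₂ s Y : ℝ) ≤
      Nat.card (Colouring C₀ C₁ C₂ X) * Nat.card (Rest C₁ C₂ (Quotient s) Y) *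
      (Real.exp (((Fintype.card X + Fintype.card Y : ℕ) : ℝ) ^ 2 *
        decay (Fintype.card X) (Fintype.card Y)) - 1) := by
  classical
  set ρ := decay (Fintype.card X) (Fintype.card Y) with hρdef
  have hρ0 : 0 < ρ := Real.rpow_pos_of_pos two_pos _
  have hρ1 : ρ ≤ 1 := Real.rpow_le_one_of_one_le_of_nonpos one_le_two (by
    rw [neg_div]; exact neg_nonpos.2 (by positivity))
  set K : ℝ := ((Nat.card (Colouring C₀ C₁ C₂ X × Rest C₁ C₂ (Quotient s) Y) : ℕ) : ℝ) with hK
  have hone : ∀ g : Equiv.Perm (X ⊕ Y), g ∉ blockStab (ext s Y) →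
      (Nat.card {p : Colouring C₀ C₁ C₂ X × Rest C₁ C₂ (Quotient s) Y //
        g ∈ autC (glue s p)} : ℝ) ≤ K * ρ ^ g.support.card := by
    intro g hg
    obtain ⟨d, hd, h⟩ := card_fixed_mul_le (C₀ := C₀) (C₁ := C₁) hC s hg
    have h' : (Nat.card {p : Colouring C₀ C₁ C₂ X × Rest C₁ C₂ (Quotient s) Y //
        g ∈ autC (glue s p)} : ℝ) * 2 ^ (d * Nat.card Y) ≤ K := by
      rw [hK]; exact_mod_cast h
    -- The exponent in `decay` is chosen so that this cancellation is exact.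
    have h3 : ρ ^ ((Fintype.card X + 3) * d) * 2 ^ (d * Nat.card Y) = 1 := by
      rw [hρdef, decay, Nat.card_eq_fintype_card, ← Real.rpow_natCast, ← Real.rpow_mul two_pos.le,
        ← Real.rpow_natCast, ← Real.rpow_add two_pos]
      convert Real.rpow_zero 2
      push_cast
      field_simp
      ring
    have h4 : ρ ^ ((Fintype.card X + 3) * d) ≤ ρ ^ g.support.card :=
      pow_le_pow_of_le_one hρ0.le hρ1 hd
    calc _ = (Nat.card {p : Colouring C₀ C₁ C₂ X × Rest C₁ C₂ (Quotient s) Y //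
        g ∈ autC (glue s p)} : ℝ) * 2 ^ (d * Nat.card Y) * ρ ^ ((Fintype.card X + 3) * d) := by
          rw [mul_assoc, mul_comm (2 ^ _), h3, mul_one]
      _ ≤ K * ρ ^ ((Fintype.card X + 3) * d) := by gcongr
      _ ≤ _ := by gcongr
  have hinj : errCount C₀ C₁ C₂ s Y ≤
      Nat.card (Σ g : {g : Equiv.Perm (X ⊕ Y) // g ∉ blockStab (ext s Y)},
        {p : Colouring C₀ C₁ C₂ X × Rest C₁ C₂ (Quotient s) Y // g.1 ∈ autC (glue s p)}) := by
    have : Finite {g : Equiv.Perm (X ⊕ Y) // g ∉ blockStab (ext s Y)} := Subtype.finite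
    have : ∀ g : {g : Equiv.Perm (X ⊕ Y) // g ∉ blockStab (ext s Y)}, Finite
        {p : Colouring C₀ C₁ C₂ X × Rest C₁ C₂ (Quotient s) Y // g.1 ∈ autC (glue s p)} :=
      fun g => Subtype.finite
    have : Finite (Σ g : {g : Equiv.Perm (X ⊕ Y) // g ∉ blockStab (ext s Y)},
        {p : Colouring C₀ C₁ C₂ X × Rest C₁ C₂ (Quotient s) Y // g.1 ∈ autC (glue s p)}) :=
      inferInstance
    refine Nat.card_le_card_of_surjective (fun q => ⟨q.2.1, fun h => q.1.2 (h q.2.2)⟩) ?_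
    rintro ⟨p, hp⟩
    obtain ⟨g, hg, hg'⟩ := Set.not_subset.1 hp
    exact ⟨⟨⟨g, hg'⟩, p, hg⟩, rfl⟩
  rw [Nat.card_sigma] at hinj
  calc (errCount C₀ C₁ C₂ s Y : ℝ) ≤ _ := Nat.cast_le.2 hinj
    _ ≤ ∑ g : {g : Equiv.Perm (X ⊕ Y) // g ∉ blockStab (ext s Y)}, K * ρ ^ g.1.support.card := by
        push_cast
        exact Finset.sum_le_sum fun g _ => hone g.1 g.2
    _ = K * ∑ g ∈ Finset.univ.filter (· ∉ blockStab (ext s Y)), ρ ^ g.support.card := by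
        rw [← Finset.mul_sum]
        congr 1
        exact (Finset.sum_subtype _ (by simp) (fun g : Equiv.Perm (X ⊕ Y) =>
          ρ ^ g.support.card)).symm
    _ ≤ K * (Real.exp (((Fintype.card X + Fintype.card Y : ℕ) : ℝ) ^ 2 * ρ) - 1) := by
        gcongr
        rw [le_sub_iff_add_le]
        have := sum_perm_pow_support_le (A := X ⊕ Y) hρ0.le
        rw [Fintype.card_sum] at this
        refine le_trans ?_ this
        -- The identity preserves the blocks, so its term 1 is available to be subtracted from the
        -- full sum; without this the bound would not tend to 0.
        have h1 : (1 : Equiv.Perm (X ⊕ Y)) ∉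
            Finset.univ.filter (· ∉ blockStab (ext s Y)) := by
          simp
        calc _ = ∑ g ∈ insert 1 (Finset.univ.filter (· ∉ blockStab (ext s Y))),
              ρ ^ g.support.card := by
              rw [Finset.sum_insert h1, add_comm]; simp
          _ ≤ _ := Finset.sum_le_sum_of_subset_of_nonneg (Finset.subset_univ _)
            fun g _ _ => by positivity
    _ = _ := by rw [hK, Nat.card_prod]; push_cast; rfl

theorem tendsto_pow_mul_decay (m k : ℕ) :
    Tendsto (fun N : ℕ => ((m + N : ℕ) : ℝ) ^ k * decay m N) atTop (𝓝 0) := by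
  set r : ℝ := (2 : ℝ) ^ (-(1 : ℝ) / (m + 3)) with hr
  have hr0 : 0 < r := Real.rpow_pos_of_pos two_pos _
  have hr1 : r < 1 := Real.rpow_lt_one_of_one_lt_of_neg one_lt_two (by
    rw [neg_div]; exact neg_neg_of_pos (by positivity))
  have hd : ∀ N, decay m N = r ^ N := fun N => by
    rw [decay, hr, ← Real.rpow_natCast, ← Real.rpow_mul two_pos.le]
    congr 1
    ring
  have h := (tendsto_pow_const_mul_const_pow_of_lt_one k hr0.le hr1).comp (tendsto_add_atTop_nat m)
  have h2 := h.mul_const (r ^ m)⁻¹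
  rw [zero_mul] at h2
  refine h2.congr fun N => ?_
  simp only [Function.comp, hd, pow_add]
  rw [add_comm N m]
  field_simp

theorem tendsto_errCount_div [Finite C₀] [Finite C₁] [Finite C₂] [Fintype X] [Nonempty C₁]
    (hC : 2 ≤ Nat.card C₂) (s : Setoid X) :
    Tendsto (fun N : ℕ => (errCount C₀ C₁ C₂ s (Fin N) : ℝ) /
      Nat.card (Rest C₁ C₂ (Quotient s) (Fin N))) atTop (𝓝 0) := by
  have hne : Nonempty C₂ := (Nat.card_pos_iff.1 (by omega)).1
  have h1 := tendsto_pow_mul_decay (Fintype.card X) 2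
  have h2 := ((Real.continuous_exp.tendsto 0).comp h1).sub_const 1
  rw [Real.exp_zero, sub_self] at h2
  have h3 := h2.const_mul (Nat.card (Colouring C₀ C₁ C₂ X) : ℝ)
  rw [mul_zero] at h3
  refine squeeze_zero (fun N => by positivity) (fun N => ?_) h3
  have hR : (0 : ℝ) < Nat.card (Rest C₁ C₂ (Quotient s) (Fin N)) :=
    Nat.cast_pos.2 Nat.card_pos
  rw [div_le_iff₀ hR]
  have := errCount_le (C₀ := C₀) (C₁ := C₁) (Y := Fin N) hC s
  rw [Fintype.card_fin] at this
  refine this.trans (le_of_eq ?_)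
  simp only [Function.comp]
  ring

end UnionBound

/-! ### Groups acting on k pairs and a triple -/

section BlockGroup

/-- Such a group is abelian, hence a vector space over the field with two elements; t is its
dimension. -/
theorem exists_mulEquiv_of_mul_self {G : Type} [Group G] [Finite G] (h : ∀ g : G, g * g = 1) :
    ∃ t : ℕ, Nat.card G = 2 ^ t ∧ Nonempty (G ≃* (Fin t → Z 2)) := by
  let _ : CommGroup G :=
    { ‹Group G› with
      mul_comm := fun a b => by
        have h1 := h (a * b)
        have ha : a⁻¹ = a := inv_eq_of_mul_eq_one_right (h a)
        have hb : b⁻¹ = b := inv_eq_of_mul_eq_one_right (h b)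
        rw [← inv_eq_of_mul_eq_one_right h1, mul_inv_rev, ha, hb] }
  let _ : Module (ZMod 2) (Additive G) := AddCommGroup.zmodModule (n := 2) (fun x => by
    rw [two_nsmul]
    exact h x.toMul)
  have : Finite (Additive G) := ‹Finite G›
  let e := (Module.finBasis (ZMod 2) (Additive G)).equivFun.toAddEquiv
  refine ⟨Module.finrank (ZMod 2) (Additive G), ?_, ⟨?_⟩⟩
  · have := Nat.card_congr e.toEquiv
    rw [Nat.card_fun] at this
    rw [Nat.card_zmod, Nat.card_fin] at this
    exact this
  · exact
      { toFun := fun g i => Multiplicative.ofAdd (e (Additive.ofMul g) i)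
        invFun := fun v => (e.symm fun i => (v i).toAdd).toMul
        left_inv := fun g => e.symm_apply_apply (Additive.ofMul g)
        right_inv := fun v => e.apply_symm_apply fun i => (v i).toAdd
        map_mul' := fun a b => e.map_add (Additive.ofMul a) (Additive.ofMul b) }

theorem perm_two_mul_self : ∀ g : Equiv.Perm (Fin 2), g * g = 1 := by decide

theorem nonempty_mulEquiv_of_finRotate_mem {H : Subgroup Sym3} (h : finRotate 3 ∈ H) :
    (H ≠ ⊤ → Nonempty (H ≃* Z 3)) ∧ (H = ⊤ → Nonempty (H ≃* Sym3)) := by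
  constructor
  · intro hH
    have h1 : Nat.card H ∣ 6 := by
      have := Subgroup.card_subgroup_dvd_card H
      rwa [Nat.card_perm, Nat.card_fin] at this
    have h2 : 3 ∣ Nat.card H := by
      have h3 : orderOf (⟨finRotate 3, h⟩ : H) = 3 := by
        rw [Subgroup.orderOf_mk]
        exact orderOf_eq_prime (by decide) (by decide)
      have h4 := orderOf_dvd_natCard (⟨finRotate 3, h⟩ : H)
      rwa [h3] at h4
    have h3 : Nat.card H ≠ 6 := by
      intro h6
      apply hH
      apply Subgroup.eq_top_of_card_eq
      rw [h6, Nat.card_perm, Nat.card_fin]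
      rfl
    have h4 : Nat.card H = 3 := by
      have := Nat.le_of_dvd (by norm_num) h1
      interval_cases Nat.card H <;> omega
    have : Fact (Nat.Prime 3) := ⟨Nat.prime_three⟩
    exact ⟨mulEquivOfPrimeCardEq (p := 3) h4 (by simp)⟩
  · rintro rfl
    exact ⟨Subgroup.topEquiv⟩

/-- The left group is abelian and the right one is not. -/
theorem not_nonempty_mulEquiv_Z3_Sym3 (t t' : ℕ) :
    ¬ Nonempty (((Fin t → Z 2) × Z 3) ≃* ((Fin t' → Z 2) × Sym3)) := by
  rintro ⟨e⟩
  have h : ∀ a b : (Fin t' → Z 2) × Sym3, a * b = b * a := by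
    intro a b
    apply e.symm.injective
    rw [map_mul, map_mul, mul_comm]
  have h1 : finRotate 3 * Equiv.swap 0 1 = Equiv.swap 0 1 * finRotate 3 :=
    congrArg Prod.snd (h (1, finRotate 3) (1, Equiv.swap 0 1))
  exact absurd h1 (by decide)

/-- The support: `k` pairs and a triple. -/
abbrev Blocks (k : ℕ) : Type := (Fin k × Fin 2) ⊕ Fin 3

/-- The partition of the support into pairs and a triple. -/
def blocks (k : ℕ) : Setoid (Blocks k) :=
  Setoid.ker (Sum.map Prod.fst (fun _ : Fin 3 => ()))

variable {k : ℕ}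

@[simp] theorem blocks_inl_inl {p p' : Fin k × Fin 2} :
    blocks k (.inl p) (.inl p') ↔ p.1 = p'.1 :=
  Sum.inl_injective.eq_iff

@[simp] theorem blocks_inr_inr {x x' : Fin 3} : blocks k (.inr x) (.inr x') :=
  rfl

@[simp] theorem blocks_inl_inr {p : Fin k × Fin 2} {x : Fin 3} :
    ¬ blocks k (.inl p) (.inr x) :=
  Sum.inl_ne_inr

@[simp] theorem blocks_inr_inl {p : Fin k × Fin 2} {x : Fin 3} :
    ¬ blocks k (.inr x) (.inl p) :=
  Sum.inr_ne_inl

theorem nontrivial_blocks (x : Blocks k) : ∃ y, y ≠ x ∧ blocks k x y := by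
  rcases x with ⟨j, a⟩ | x
  · exact ⟨.inl (j, a + 1), by simp, by simp⟩
  · exact ⟨.inr (x + 1), by simp, by simp⟩

/-- Independent permutations of the pairs and the triple. -/
def blockPerm (k : ℕ) : (Fin k → Equiv.Perm (Fin 2)) × Sym3 →* Equiv.Perm (Blocks k) where
  toFun q := Equiv.sumCongr
    { toFun := fun p => (p.1, q.1 p.1 p.2)
      invFun := fun p => (p.1, (q.1 p.1)⁻¹ p.2)
      left_inv := fun p => by simp
      right_inv := fun p => by simp } q.2
  map_one' := by ext (x | x) <;> rfl
  map_mul' a b := by ext (x | x) <;> rfl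

@[simp] theorem blockPerm_inl (q : (Fin k → Equiv.Perm (Fin 2)) × Sym3) (p : Fin k × Fin 2) :
    blockPerm k q (.inl p) = .inl (p.1, q.1 p.1 p.2) := rfl

@[simp] theorem blockPerm_inr (q : (Fin k → Equiv.Perm (Fin 2)) × Sym3) (x : Fin 3) :
    blockPerm k q (.inr x) = .inr (q.2 x) := rfl

theorem blockPerm_injective : Function.Injective (blockPerm k) := by
  rintro ⟨z, σ⟩ ⟨z', σ'⟩ h
  refine Prod.ext (funext fun j => Equiv.ext fun a => ?_) (Equiv.ext fun x => ?_)
  · have := Equiv.congr_fun h (.inl (j, a))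
    simpa using this
  · have := Equiv.congr_fun h (.inr x)
    simpa using this

theorem range_blockPerm : (blockPerm k).range = blockStab (blocks k) := by
  ext g
  constructor
  · rintro ⟨q, rfl⟩ (p | x) <;> simp
  · intro hg
    have h1 : ∀ g ∈ blockStab (blocks k), ∀ p : Fin k × Fin 2, ∃ a,
        g (.inl p) = .inl (p.1, a) := by
      intro g hg p
      have := hg (.inl p)
      rcases h : g (.inl p) with ⟨j, a⟩ | x
      · simp only [h, blocks_inl_inl] at this
        exact ⟨a, by rw [this]⟩
      · simp [h] at this
    have h2 : ∀ g ∈ blockStab (blocks k), ∀ x : Fin 3, ∃ y, g (.inr x) = .inr y := by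
      intro g hg x
      have := hg (.inr x)
      rcases h : g (.inr x) with p | y
      · simp [h] at this
      · exact ⟨y, rfl⟩
    choose f hf using h1 g hg
    choose f' hf' using h1 g⁻¹ (inv_mem hg)
    choose e he using h2 g hg
    choose e' he' using h2 g⁻¹ (inv_mem hg)
    have i1 : ∀ j a, f' (j, f (j, a)) = a := fun j a => by
      have : g⁻¹ (g (.inl (j, a))) = .inl (j, a) := by simp
      rw [hf, hf'] at this
      simpa using this
    have i2 : ∀ j a, f (j, f' (j, a)) = a := fun j a => by
      have : g (g⁻¹ (.inl (j, a))) = .inl (j, a) := by simp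
      rw [hf', hf] at this
      simpa using this
    have i3 : ∀ x, e' (e x) = x := fun x => by
      have : g⁻¹ (g (.inr x)) = .inr x := by simp
      rw [he, he'] at this
      simpa using this
    have i4 : ∀ x, e (e' x) = x := fun x => by
      have : g (g⁻¹ (.inr x)) = .inr x := by simp
      rw [he', he] at this
      simpa using this
    refine ⟨(fun j => ⟨fun a => f (j, a), fun a => f' (j, a), i1 j, i2 j⟩, ⟨e, e', i3, i4⟩), ?_⟩
    ext (p | x)
    · simp [hf]
    · simp [he]

variable {C₀ C₁ C₂ : Type*}

/-- The block-preserving automorphisms in terms of their actions on the blocks. -/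
def blockAut (N : Colouring C₀ C₁ C₂ (Blocks k)) :
    Subgroup ((Fin k → Equiv.Perm (Fin 2)) × Sym3) :=
  (autC N).comap (blockPerm k)

theorem map_blockAut (N : Colouring C₀ C₁ C₂ (Blocks k)) :
    (blockAut N).map (blockPerm k) = autC N ⊓ blockStab (blocks k) := by
  rw [blockAut, Subgroup.map_comap_eq, range_blockPerm, inf_comm]

theorem nonempty_blockAut_equiv (N : Colouring C₀ C₁ C₂ (Blocks k)) :
    Nonempty (blockAut N ≃* (autC N ⊓ blockStab (blocks k) : Subgroup _)) :=
  ⟨(Subgroup.equivMapOfInjective _ _ blockPerm_injective).trans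
    (MulEquiv.subgroupCongr (map_blockAut N))⟩

theorem full_blocks_iff {N : Colouring C₀ C₁ C₂ (Blocks k)} :
    Full (blocks k) N ↔ (∀ j a b, ∃ q ∈ blockAut N, q.1 j a = b) ∧
      ∀ x y, ∃ q ∈ blockAut N, q.2 x = y := by
  unfold Full
  rw [← map_blockAut]
  constructor
  · intro H
    refine ⟨fun j a b => ?_, fun x y => ?_⟩
    · obtain ⟨_, ⟨q, hq, rfl⟩, h⟩ := H (.inl (j, a)) (.inl (j, b)) (by simp)
      exact ⟨q, hq, by simpa using h⟩
    · obtain ⟨_, ⟨q, hq, rfl⟩, h⟩ := H (.inr x) (.inr y) (by simp)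
      exact ⟨q, hq, by simpa using h⟩
  · rintro ⟨H1, H2⟩ (⟨j, a⟩ | x) (⟨j', b⟩ | y) h
    · simp only [blocks_inl_inl] at h
      subst h
      obtain ⟨q, hq, rfl⟩ := H1 j a b
      exact ⟨_, ⟨q, hq, rfl⟩, rfl⟩
    · simp at h
    · simp at h
    · obtain ⟨q, hq, rfl⟩ := H2 x y
      exact ⟨_, ⟨q, hq, rfl⟩, rfl⟩

/-- If neither permutation is a 3-cycle, they are two distinct transpositions, and their products in
the two orders are the two 3-cycles. -/
theorem finRotate_eq_of_transitive : ∀ g g' : Sym3, g 0 = 1 → g' 0 = 2 →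
    finRotate 3 = g ∨ finRotate 3 = g'⁻¹ ∨ finRotate 3 = g * g' ∨ finRotate 3 = g' * g := by
  decide

theorem finRotate_mem_blockAut {N : Colouring C₀ C₁ C₂ (Blocks k)}
    (hN : ∀ x y, ∃ q ∈ blockAut N, q.2 x = y) : (1, finRotate 3) ∈ blockAut N := by
  obtain ⟨z, hz⟩ : ∃ z, (z, finRotate 3) ∈ blockAut N := by
    obtain ⟨q, hq, h⟩ := hN 0 1
    obtain ⟨q', hq', h'⟩ := hN 0 2
    rcases finRotate_eq_of_transitive q.2 q'.2 h h' with e | e | e | e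
    · exact ⟨q.1, by rw [e]; exact hq⟩
    · exact ⟨q'⁻¹.1, by rw [e]; exact inv_mem hq'⟩
    · exact ⟨(q * q').1, by rw [e]; exact mul_mem hq hq'⟩
    · exact ⟨(q' * q).1, by rw [e]; exact mul_mem hq' hq⟩
  have h2 : z * z = 1 := funext fun j => perm_two_mul_self (z j)
  -- The fourth power kills the part on the pairs, which has exponent 2, and keeps the 3-cycle.
  have h4 := mul_mem (mul_mem hz hz) (mul_mem hz hz)
  simp only [Prod.mk_mul_mk, h2, mul_one] at h4
  convert h4 using 2
  decide

/-- The rotation makes colours between pairs and triple independent of the point of the triple, so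
the action on the triple can be dropped from any automorphism. -/
theorem fst_mem_blockAut {N : Colouring C₀ C₁ C₂ (Blocks k)}
    (hN : (1, finRotate 3) ∈ blockAut N) {q : (Fin k → Equiv.Perm (Fin 2)) × Sym3}
    (hq : q ∈ blockAut N) : (q.1, 1) ∈ blockAut N := by
  have hrot : ∀ (p : Fin k × Fin 2) (x : Fin 3),
      N.2.2 (.inl p) (.inr (finRotate 3 x)) = N.2.2 (.inl p) (.inr x) ∧
      N.2.2 (.inr (finRotate 3 x)) (.inl p) = N.2.2 (.inr x) (.inl p) := by
    intro p x
    exact ⟨hN.2 (.inl p) (.inr x), hN.2 (.inr x) (.inl p)⟩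
  have hconst : ∀ (p : Fin k × Fin 2) (x y : Fin 3),
      N.2.2 (.inl p) (.inr x) = N.2.2 (.inl p) (.inr y) ∧
      N.2.2 (.inr x) (.inl p) = N.2.2 (.inr y) (.inl p) := by
    have h0 : ∀ (p : Fin k × Fin 2) (x : Fin 3),
        N.2.2 (.inl p) (.inr x) = N.2.2 (.inl p) (.inr 0) ∧
        N.2.2 (.inr x) (.inl p) = N.2.2 (.inr 0) (.inl p) := by
      intro p x
      have h1 := hrot p 0
      have h2 := hrot p 1
      rw [show finRotate 3 0 = 1 by decide] at h1
      rw [show finRotate 3 1 = 2 by decide] at h2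
      fin_cases x
      · exact ⟨rfl, rfl⟩
      · exact h1
      · exact ⟨h2.1.trans h1.1, h2.2.trans h1.2⟩
    exact fun p x y => ⟨(h0 p x).1.trans (h0 p y).1.symm, (h0 p x).2.trans (h0 p y).2.symm⟩
  refine ⟨?_, ?_⟩
  · rintro (p | x)
    · exact hq.1 (.inl p)
    · rfl
  · rintro (p | x) (p' | x')
    · exact hq.2 (.inl p) (.inl p')
    · exact ((hconst _ _ _).1).trans (hq.2 (.inl p) (.inr x'))
    · exact ((hconst _ _ _).2).trans (hq.2 (.inr x) (.inl p'))
    · rfl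

/-- The condition `1 ≤ k → 1 ≤ t` treats the lone triple (k = 0, so t = 0) together with the case
where some pair must be swapped. -/
theorem exists_mulEquiv_of_full {N : Colouring C₀ C₁ C₂ (Blocks k)} (hN : Full (blocks k) N) :
    ∃ t : ℕ, t ≤ k ∧ (1 ≤ k → 1 ≤ t) ∧
      (Nonempty ((autC N ⊓ blockStab (blocks k) : Subgroup _) ≃* (Fin t → Z 2) × Z 3) ∨
       Nonempty ((autC N ⊓ blockStab (blocks k) : Subgroup _) ≃* (Fin t → Z 2) × Sym3)) := by
  obtain ⟨hp, ht⟩ := full_blocks_iff.1 hN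
  have hrot := finRotate_mem_blockAut ht
  set H₁ := (blockAut N).map (MonoidHom.fst _ _) with hH₁
  set H₂ := (blockAut N).map (MonoidHom.snd _ _) with hH₂
  -- Both components of an automorphism are automorphisms separately, so the subgroup is the product
  -- of its projections.
  have hprod : blockAut N = H₁.prod H₂ := by
    apply le_antisymm
    · intro q hq
      exact ⟨⟨q, hq, rfl⟩, ⟨q, hq, rfl⟩⟩
    · rintro ⟨z, σ⟩ ⟨⟨q, hq, rfl⟩, ⟨q', hq', rfl⟩⟩
      have h1 := fst_mem_blockAut hrot hq
      have h2 := mul_mem (inv_mem (fst_mem_blockAut hrot hq')) hq'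
      have h3 := mul_mem h1 h2
      convert h3 using 1
      ext <;> simp
  have hH₂rot : finRotate 3 ∈ H₂ := ⟨_, hrot, rfl⟩
  have hsq : ∀ g : H₁, g * g = 1 := by
    rintro ⟨g, hg⟩
    exact Subtype.ext (funext fun j => perm_two_mul_self (g j))
  obtain ⟨t, hcard, ⟨e₁⟩⟩ := exists_mulEquiv_of_mul_self hsq
  obtain ⟨e⟩ := nonempty_blockAut_equiv N
  refine ⟨t, ?_, ?_, ?_⟩
  · have h1 : Nat.card H₁ ≤ Nat.card (Fin k → Equiv.Perm (Fin 2)) := Subgroup.card_le_card_group _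
    have h2 : Nat.card (Fin k → Equiv.Perm (Fin 2)) = 2 ^ k := by
      simp [Fintype.card_perm]
    rw [hcard, h2] at h1
    exact (Nat.pow_le_pow_iff_right one_lt_two).1 h1
  · intro hk
    by_contra h0
    obtain rfl : t = 0 := by omega
    rw [pow_zero] at hcard
    have hbot := Subgroup.eq_bot_of_card_eq _ hcard
    obtain ⟨q, hq, h⟩ := hp ⟨0, hk⟩ 0 1
    have : q.1 ∈ H₁ := ⟨q, hq, rfl⟩
    rw [hbot, Subgroup.mem_bot] at this
    simp [this] at h
  · have e' := e.symm.trans ((MulEquiv.subgroupCongr hprod).trans (Subgroup.prodEquiv H₁ H₂))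
    by_cases hT : H₂ = ⊤
    · obtain ⟨e₂⟩ := (nonempty_mulEquiv_of_finRotate_mem hH₂rot).2 hT
      exact .inr ⟨e'.trans (e₁.prodCongr e₂)⟩
    · obtain ⟨e₂⟩ := (nonempty_mulEquiv_of_finRotate_mem hH₂rot).1 hT
      exact .inl ⟨e'.trans (e₁.prodCongr e₂)⟩

/-! ### Realising every group -/

open Classical in
/-- A colouring in which `f` tells which pairs are linked and `T` is a relation on the triple. -/
noncomputable def linked {t : ℕ} (c₀ : C₀) (c₁ : C₁) (α β : C₂) (f : Fin k → Fin t)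
    (T : Fin 3 → Fin 3 → Prop) : Colouring C₀ C₁ C₂ (Blocks k) :=
  (c₀, fun _ => c₁, fun a b =>
    match a, b with
    | .inl p, .inl p' => if f p.1 = f p'.1 ∧ p.2 = p'.2 then α else β
    | .inr x, .inr y => if T x y then α else β
    | .inl _, .inr _ => β
    | .inr _, .inl _ => β)

/-- Colour α matches equal positions in linked pairs, so linked pairs are swapped simultaneously and
unlinked ones independently. -/
theorem mem_blockAut_linked {t : ℕ} {c₀ : C₀} {c₁ : C₁} {α β : C₂} (hαβ : α ≠ β)
    {f : Fin k → Fin t} {T : Fin 3 → Fin 3 → Prop}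
    {q : (Fin k → Equiv.Perm (Fin 2)) × Sym3} :
    q ∈ blockAut (linked c₀ c₁ α β f T) ↔
      (∀ j j', f j = f j' → q.1 j = q.1 j') ∧ ∀ x y, T (q.2 x) (q.2 y) ↔ T x y := by
  have hite : ∀ p p' : Prop, ∀ [Decidable p] [Decidable p'],
      (if p then α else β) = (if p' then α else β) ↔ (p ↔ p') := by
    intro p p' _ _
    by_cases hp : p <;> by_cases hp' : p' <;> simp [hp, hp', hαβ, hαβ.symm]
  constructor
  · intro h
    refine ⟨fun j j' hj => ?_, fun x y => ?_⟩
    · ext a : 1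
      have := h.2 (.inl (j, a)) (.inl (j', a))
      simp only [linked, blockPerm_inl, hite, hj, true_and] at this
      simpa using this
    · have := h.2 (.inr x) (.inr y)
      simpa only [linked, blockPerm_inr, hite] using this
  · rintro ⟨h1, h2⟩
    refine ⟨fun _ => rfl, ?_⟩
    rintro (p | x) (p' | x')
    · simp only [linked, blockPerm_inl, hite]
      refine and_congr_right fun hf => ?_
      rw [h1 _ _ hf, (q.1 p'.1).injective.eq_iff]
    · rfl
    · rfl
    · simp only [linked, blockPerm_inr, hite]
      exact h2 x x'

/-- The automorphisms of a relation on the triple. -/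
def relAut (T : Fin 3 → Fin 3 → Prop) : Subgroup Sym3 where
  carrier := {σ | ∀ x y, T (σ x) (σ y) ↔ T x y}
  one_mem' := fun _ _ => Iff.rfl
  mul_mem' := fun {a b} ha hb x y => (ha (b x) (b y)).trans (hb x y)
  inv_mem' := fun {a} ha x y => by
    rw [← ha]; simp

theorem exists_full_mulEquiv [Nonempty C₀] [Nonempty C₁] {α β : C₂} (hαβ : α ≠ β)
    {t : ℕ} {f : Fin k → Fin t} (hf : Function.Surjective f) {T : Fin 3 → Fin 3 → Prop}
    (hT : finRotate 3 ∈ relAut T) :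
    ∃ N : Colouring C₀ C₁ C₂ (Blocks k), Full (blocks k) N ∧
      Nonempty ((autC N ⊓ blockStab (blocks k) : Subgroup _) ≃* (Fin t → Z 2) × relAut T) := by
  obtain ⟨c₀⟩ := ‹Nonempty C₀›
  obtain ⟨c₁⟩ := ‹Nonempty C₁›
  let N : Colouring C₀ C₁ C₂ (Blocks k) := linked c₀ c₁ α β f T
  let ψ : (Fin t → Equiv.Perm (Fin 2)) × relAut T →*
      (Fin k → Equiv.Perm (Fin 2)) × Sym3 :=
    { toFun := fun q => (fun j => q.1 (f j), q.2)
      map_one' := rfl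
      map_mul' := fun _ _ => rfl }
  have hψ : Function.Injective ψ := by
    rintro ⟨z, σ⟩ ⟨z', σ'⟩ h
    obtain ⟨h1, h2⟩ := Prod.mk.inj h
    refine Prod.ext (funext fun i => ?_) (Subtype.ext h2)
    obtain ⟨j, rfl⟩ := hf i
    exact congrFun h1 j
  have hrange : ψ.range = blockAut N := by
    ext q
    rw [mem_blockAut_linked hαβ]
    constructor
    · rintro ⟨q, rfl⟩
      exact ⟨fun j j' h => congrArg q.1 h, q.2.2⟩
    · rintro ⟨h1, h2⟩
      refine ⟨(fun i => q.1 (Function.surjInv hf i), ⟨q.2, h2⟩), ?_⟩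
      refine Prod.ext (funext fun j => ?_) rfl
      exact h1 _ _ (Function.surjInv_eq hf _)
  refine ⟨N, full_blocks_iff.2 ⟨fun j a b => ?_, fun x y => ?_⟩, ?_⟩
  · rw [← hrange]
    exact ⟨_, ⟨(fun _ => Equiv.swap a b, 1), rfl⟩, Equiv.swap_apply_left _ _⟩
  · rw [← hrange]
    have : ∃ n : ℕ, (finRotate 3 ^ n) x = y := by
      revert x y
      have : ∀ x y : Fin 3, ∃ n : Fin 3, (finRotate 3 ^ (n : ℕ)) x = y := by decide
      exact fun x y => ⟨_, (this x y).choose_spec⟩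
    obtain ⟨n, hn⟩ := this
    exact ⟨_, ⟨(1, ⟨_, pow_mem hT n⟩), rfl⟩, hn⟩
  · obtain ⟨e⟩ := nonempty_blockAut_equiv N
    have : Fact (Nat.Prime 2) := ⟨Nat.prime_two⟩
    have e₂ : Equiv.Perm (Fin 2) ≃* Z 2 :=
      mulEquivOfPrimeCardEq (p := 2) (by simp [Fintype.card_perm]) (by simp)
    exact ⟨e.symm.trans ((MulEquiv.subgroupCongr hrange.symm).trans
      ((MonoidHom.ofInjective hψ).symm.trans
        ((MulEquiv.piCongrRight fun _ => e₂).prodCongr (MulEquiv.refl _))))⟩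

theorem exists_surjective_fin {t : ℕ} (h : t ≤ k) (h' : 1 ≤ k → 1 ≤ t) :
    ∃ f : Fin k → Fin t, Function.Surjective f := by
  refine ⟨fun j => ⟨min j (t - 1), ?_⟩, fun i => ⟨⟨i, i.2.trans_le h⟩, ?_⟩⟩
  · have := j.2
    have := h' (by omega)
    omega
  · ext
    have := i.2
    simp only
    omega

theorem exists_full_Z3 [Nonempty C₀] [Nonempty C₁] {α β : C₂} (hαβ : α ≠ β)
    {t : ℕ} (h : t ≤ k) (h' : 1 ≤ k → 1 ≤ t) :
    ∃ N : Colouring C₀ C₁ C₂ (Blocks k), Full (blocks k) N ∧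
      Nonempty ((autC N ⊓ blockStab (blocks k) : Subgroup _) ≃* (Fin t → Z 2) × Z 3) := by
  obtain ⟨f, hf⟩ := exists_surjective_fin h h'
  -- A directed triangle: rotations preserve it and transpositions reverse it.
  have hT : finRotate 3 ∈ relAut fun x y => y = finRotate 3 x := by
    intro x y
    simp
  obtain ⟨N, hN, ⟨e⟩⟩ := exists_full_mulEquiv (C₀ := C₀) (C₁ := C₁) hαβ hf hT
  have hne : (relAut fun x y => y = finRotate 3 x) ≠ ⊤ := by
    intro htop
    have : Equiv.swap 0 1 ∈ relAut fun x y => y = finRotate 3 x := htop ▸ Subgroup.mem_top _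
    have := (this 0 1).2 (by decide)
    revert this
    decide
  obtain ⟨e₂⟩ := (nonempty_mulEquiv_of_finRotate_mem hT).1 hne
  exact ⟨N, hN, ⟨e.trans ((MulEquiv.refl _).prodCongr e₂)⟩⟩

theorem exists_full_Sym3 [Nonempty C₀] [Nonempty C₁] {α β : C₂} (hαβ : α ≠ β)
    {t : ℕ} (h : t ≤ k) (h' : 1 ≤ k → 1 ≤ t) :
    ∃ N : Colouring C₀ C₁ C₂ (Blocks k), Full (blocks k) N ∧
      Nonempty ((autC N ⊓ blockStab (blocks k) : Subgroup _) ≃* (Fin t → Z 2) × Sym3) := by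
  obtain ⟨f, hf⟩ := exists_surjective_fin h h'
  have htop : (relAut fun _ _ => True) = ⊤ := by
    ext σ
    simp [relAut]
  have hT : finRotate 3 ∈ relAut fun _ _ => True := htop ▸ Subgroup.mem_top _
  obtain ⟨N, hN, ⟨e⟩⟩ := exists_full_mulEquiv (C₀ := C₀) (C₁ := C₁) hαβ hf hT
  obtain ⟨e₂⟩ := (nonempty_mulEquiv_of_finRotate_mem hT).2 htop
  exact ⟨N, hN, ⟨e.trans ((MulEquiv.refl _).prodCongr e₂)⟩⟩

end BlockGroup

/-! ### Transport to the universe `Fin n` -/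

section Transport

variable {C₀ C₁ C₂ : Type*} {A B X Y : Type}

/-- Transport of colourings along a bijection. -/
def mapCol (e : A ≃ B) : Colouring C₀ C₁ C₂ A ≃ Colouring C₀ C₁ C₂ B where
  toFun M := (M.1, fun x => M.2.1 (e.symm x), fun x y => M.2.2 (e.symm x) (e.symm y))
  invFun M := (M.1, fun x => M.2.1 (e x), fun x y => M.2.2 (e x) (e y))
  left_inv M := by simp
  right_inv M := by simp

theorem permCongrHom_mem_autC {e : A ≃ B} {M : Colouring C₀ C₁ C₂ A} {g : Equiv.Perm A} :
    e.permCongrHom g ∈ autC (mapCol e M) ↔ g ∈ autC M := by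
  constructor
  · intro h
    refine ⟨fun x => ?_, fun x y => ?_⟩
    · simpa [mapCol] using h.1 (e x)
    · simpa [mapCol] using h.2 (e x) (e y)
  · intro h
    refine ⟨fun x => ?_, fun x y => ?_⟩
    · simpa [mapCol] using h.1 (e.symm x)
    · simpa [mapCol] using h.2 (e.symm x) (e.symm y)

theorem map_autC (e : A ≃ B) (M : Colouring C₀ C₁ C₂ A) :
    (autC M).map e.permCongrHom.toMonoidHom = autC (mapCol e M) := by
  ext g
  constructor
  · rintro ⟨g, hg, rfl⟩
    exact permCongrHom_mem_autC.2 hg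
  · intro hg
    obtain ⟨g, rfl⟩ := e.permCongrHom.surjective g
    exact ⟨g, permCongrHom_mem_autC.1 hg, rfl⟩

theorem nonempty_autC_mapCol_equiv (e : A ≃ B) (M : Colouring C₀ C₁ C₂ A) :
    Nonempty (autC M ≃* autC (mapCol e M)) :=
  ⟨(Subgroup.equivMapOfInjective _ _ e.permCongrHom.injective).trans
    (MulEquiv.subgroupCongr (map_autC e M))⟩

theorem orb_autC_mapCol (e : A ≃ B) (M : Colouring C₀ C₁ C₂ A) :
    orb (autC (mapCol e M)) = (orb (autC M)).comap e.symm := by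
  ext x y
  change (∃ g ∈ autC (mapCol e M), g x = y) ↔ ∃ g ∈ autC M, g (e.symm x) = e.symm y
  rw [← map_autC]
  constructor
  · rintro ⟨_, ⟨g, hg, rfl⟩, rfl⟩
    exact ⟨g, hg, by simp⟩
  · rintro ⟨g, hg, h⟩
    exact ⟨_, ⟨g, hg, rfl⟩, by simp [h]⟩

theorem comap_symm_injective (e : A ≃ B) :
    Function.Injective (fun r : Setoid A => r.comap e.symm) := by
  intro r r' h
  ext x y
  have := congrArg (fun q : Setoid B => q (e x) (e y)) h
  simpa [Setoid.comap_rel] using this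

theorem orbCount_comap (e : A ≃ B) (r : Setoid A) {P : (G : Type) → [Group G] → Prop}
    (hP : IsoInvariant P) :
    orbCount C₀ C₁ C₂ (r.comap e.symm) P = orbCount C₀ C₁ C₂ r P := by
  refine (Nat.card_congr ((mapCol e).subtypeEquiv fun M => ?_)).symm
  rw [orb_autC_mapCol, (comap_symm_injective e).eq_iff]
  obtain ⟨f⟩ := nonempty_autC_mapCol_equiv e M
  rw [hP.iff f]

/-- The elements in nontrivial classes. -/
def moved (r : Setoid A) : Set A := {a | ∃ b, b ≠ a ∧ r a b}

theorem moved_comap (e : A ≃ B) (r : Setoid A) : moved (r.comap e.symm) = e '' moved r := by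
  ext b
  simp only [moved, Setoid.comap_rel, Set.mem_ofPred_eq, Set.mem_image]
  constructor
  · rintro ⟨c, hc, h⟩
    exact ⟨e.symm b, ⟨e.symm c, by simpa using hc, h⟩, by simp⟩
  · rintro ⟨a, ⟨c, hc, h⟩, rfl⟩
    exact ⟨e c, by simpa using hc, by simpa using h⟩

theorem moved_ext {s : Setoid X} (hs : ∀ x, ∃ y, y ≠ x ∧ s x y) :
    moved (ext s Y) = Set.range Sum.inl := by
  ext (x | y)
  · obtain ⟨x', h, h'⟩ := hs x
    simp only [Set.mem_range_self, iff_true]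
    exact ⟨.inl x', by simpa using h, by simpa using h'⟩
  · simp only [moved, Set.mem_ofPred_eq, Set.mem_range, reduceCtorEq, exists_false, iff_false]
    rintro ⟨x | y', h, h'⟩
    · simp at h'
    · simp only [ext_inr_inr] at h'
      exact h (by rw [h'])

theorem exists_ext_of_ncard_moved {m N : ℕ} {r : Setoid (Fin (m + N))}
    (hr : (moved r).ncard = m) :
    ∃ s : Setoid (Fin m), (∀ x, ∃ y, y ≠ x ∧ s x y) ∧
      ∃ e : Fin m ⊕ Fin N ≃ Fin (m + N), r = (ext s (Fin N)).comap e.symm := by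
  classical
  have h1 : Nat.card (moved r) = Nat.card (Fin m) := by
    rw [Nat.card_coe_set_eq, hr, Nat.card_fin]
  have h2 : Nat.card ((moved r)ᶜ : Set _) = Nat.card (Fin N) := by
    have := Set.ncard_add_ncard_compl (moved r)
    rw [Nat.card_fin] at this
    rw [Nat.card_coe_set_eq, Nat.card_fin]
    omega
  obtain ⟨e₁⟩ := Finite.card_eq.1 h1
  obtain ⟨e₂⟩ := Finite.card_eq.1 h2
  let e : Fin m ⊕ Fin N ≃ Fin (m + N) :=
    (Equiv.sumCongr e₁.symm e₂.symm).trans (Equiv.Set.sumCompl (moved r))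
  have hl : ∀ x, e (.inl x) ∈ moved r := fun x => by
    simp [e]
  have hr' : ∀ y, e (.inr y) ∉ moved r := fun y => by
    exact (e₂.symm y).2
  have hsingle : ∀ y b, r (e (.inr y)) b → b = e (.inr y) := fun y b h => by
    by_contra hne
    exact hr' y ⟨b, hne, h⟩
  refine ⟨r.comap fun x => e (.inl x), fun x => ?_, e, ?_⟩
  · obtain ⟨b, hb, h⟩ := hl x
    obtain ⟨x' | y, rfl⟩ := e.surjective b
    · exact ⟨x', fun h' => hb (by rw [h']), h⟩
    · exact absurd (hsingle y _ (r.symm h)) hb.symm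
  · ext a b
    obtain ⟨a, rfl⟩ := e.surjective a
    obtain ⟨b, rfl⟩ := e.surjective b
    change _ ↔ ext _ _ (e.symm (e a)) (e.symm (e b))
    rw [e.symm_apply_apply, e.symm_apply_apply]
    rcases a with x | y <;> rcases b with x' | y'
    · rw [ext_inl_inl]
      rfl
    · simp only [ext_inl_inr, iff_false]
      intro h
      have := hsingle _ _ (r.symm h)
      simp at this
    · simp only [ext_inr_inl, iff_false]
      intro h
      have := hsingle _ _ h
      simp at this
    · rw [ext_inr_inr]
      constructor
      · intro h
        have := hsingle _ _ h
        simpa using this.symm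
      · rintro rfl
        exact r.refl _

/-! ### Partitions of 2k + 3 points into nontrivial classes -/

theorem exists_equiv_of_card_fiber {I J : Type} [Finite A] [Finite B] {f : A → I} {g : B → J}
    (σ : I ≃ J) (h : ∀ i, Nat.card {a // f a = i} = Nat.card {b // g b = σ i}) :
    ∃ e : A ≃ B, ∀ a, g (e a) = σ (f a) := by
  have h' : ∀ i, Nonempty ({a // f a = i} ≃ {b // g b = σ i}) := fun i => Finite.card_eq.1 (h i)
  let F' := fun i => Classical.choice (h' i)
  refine ⟨(Equiv.sigmaFiberEquiv f).symm.trans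
    ((Equiv.sigmaCongr σ F').trans (Equiv.sigmaFiberEquiv g)), fun a => ?_⟩
  exact (F' (f a) ⟨a, rfl⟩).2

theorem card_fiber_blocks_inl {k : ℕ} (j : Fin k) :
    Nat.card {x : Blocks k // Sum.map Prod.fst (fun _ : Fin 3 => ()) x = .inl j} = 2 := by
  refine Eq.trans ?_ (Nat.card_fin 2)
  refine (Nat.card_congr (Equiv.ofBijective (fun a => ⟨.inl (j, a), rfl⟩) ⟨?_, ?_⟩)).symm
  · intro a b h
    simpa using Subtype.ext_iff.1 h
  · rintro ⟨⟨j', a⟩ | x, h⟩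
    · simp only [Sum.map_inl, Sum.inl.injEq] at h
      subst h
      exact ⟨a, rfl⟩
    · simp at h

theorem card_fiber_blocks_inr {k : ℕ} (u : Unit) :
    Nat.card {x : Blocks k // Sum.map Prod.fst (fun _ : Fin 3 => ()) x = .inr u} = 3 := by
  refine Eq.trans ?_ (Nat.card_fin 3)
  refine (Nat.card_congr (Equiv.ofBijective (fun a => ⟨.inr a, rfl⟩) ⟨?_, ?_⟩)).symm
  · intro a b h
    simpa using Subtype.ext_iff.1 h
  · rintro ⟨⟨j', a⟩ | x, h⟩
    · simp at h
    · exact ⟨x, rfl⟩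

theorem card_quotient_blocks (k : ℕ) : Nat.card (Quotient (blocks k)) = k + 1 := by
  have hsurj : Function.Surjective
      (Sum.map Prod.fst (fun _ => ()) : Blocks k → Fin k ⊕ Unit) := by
    rintro (j | u)
    · exact ⟨.inl (j, 0), rfl⟩
    · exact ⟨.inr 0, rfl⟩
  have := Nat.card_congr (Setoid.quotientKerEquivOfSurjective _ hsurj)
  simpa [blocks] using this

/-- Class sizes are at least 2 and sum to 2k + 3. More than k classes means exactly k + 1, which
leaves an excess of 1 over 2 per class: one triple, the rest pairs. -/
theorem card_quotient_le_or_exists_blocks {k : ℕ} {s : Setoid (Fin (2 * k + 3))}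
    (hs : ∀ x, ∃ y, y ≠ x ∧ s x y) :
    Nat.card (Quotient s) ≤ k ∨
      ∃ e : Blocks k ≃ Fin (2 * k + 3), s = (blocks k).comap e.symm := by
  classical
  refine or_iff_not_imp_left.2 fun hk => ?_
  let c : Quotient s → ℕ := fun q => Nat.card {x // (⟦x⟧ : Quotient s) = q}
  have hc2 : ∀ q, 2 ≤ c q := by
    intro q
    induction q using Quotient.inductionOn with
    | h x =>
      obtain ⟨y, hy, h⟩ := hs x
      have : Nontrivial {x' // (⟦x'⟧ : Quotient s) = ⟦x⟧} :=
        ⟨⟨x, rfl⟩, ⟨y, Quotient.sound (s.symm h)⟩, fun h => hy (Subtype.ext_iff.1 h).symm⟩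
      exact Finite.one_lt_card
  have hsum : ∑ q, c q = 2 * k + 3 := by
    have := Nat.card_congr (Equiv.sigmaFiberEquiv (Quotient.mk s))
    rwa [Nat.card_sigma, Nat.card_fin] at this
  have hcard : Nat.card (Quotient s) = k + 1 := by
    have h1 : ∑ _q : Quotient s, 2 ≤ ∑ q, c q := Finset.sum_le_sum fun q _ => hc2 q
    rw [hsum, Finset.sum_const, Finset.card_univ, ← Nat.card_eq_fintype_card, smul_eq_mul] at h1
    omega
  obtain ⟨q₀, hq₀⟩ : ∃ q₀, 3 ≤ c q₀ := by
    by_contra! h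
    have h1 : ∑ q, c q ≤ ∑ _q : Quotient s, 2 :=
      Finset.sum_le_sum fun q _ => Nat.lt_succ_iff.1 (h q)
    rw [hsum, Finset.sum_const, Finset.card_univ, ← Nat.card_eq_fintype_card, hcard,
      smul_eq_mul] at h1
    omega
  have hsplit := Finset.add_sum_erase Finset.univ c (Finset.mem_univ q₀)
  have hconst : ∑ _q ∈ Finset.univ.erase q₀, 2 = 2 * k := by
    rw [Finset.sum_const, Finset.card_erase_of_mem (Finset.mem_univ _), Finset.card_univ,
      ← Nat.card_eq_fintype_card, hcard, smul_eq_mul]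
    simp [mul_comm]
  have hle : ∑ _q ∈ Finset.univ.erase q₀, 2 ≤ ∑ q ∈ Finset.univ.erase q₀, c q :=
    Finset.sum_le_sum fun q _ => hc2 q
  have hc3 : c q₀ = 3 := by omega
  have hrest : ∀ q, q ≠ q₀ → c q = 2 := by
    have h1 : ∑ _q ∈ Finset.univ.erase q₀, 2 = ∑ q ∈ Finset.univ.erase q₀, c q := by omega
    intro q hq
    exact ((Finset.sum_eq_sum_iff_of_le fun q _ => hc2 q).1 h1 q
      (Finset.mem_erase.2 ⟨hq, Finset.mem_univ _⟩)).symm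
  have hne : Nat.card {q // q ≠ q₀} = Nat.card (Fin k) := by
    rw [Nat.card_fin, Nat.card_eq_fintype_card, Fintype.card_subtype_compl,
      ← Nat.card_eq_fintype_card, hcard]
    simp
  obtain ⟨σ₁⟩ := Finite.card_eq.1 hne
  let σ : Fin k ⊕ Unit ≃ Quotient s :=
    { toFun := Sum.elim (fun j => (σ₁.symm j).1) fun _ => q₀
      invFun := fun q => if h : q = q₀ then .inr () else .inl (σ₁ ⟨q, h⟩)
      left_inv := by
        rintro (j | u)
        · simp [(σ₁.symm j).2]
        · simp
      right_inv := fun q => by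
        by_cases h : q = q₀ <;> simp [h] }
  obtain ⟨e, he⟩ := exists_equiv_of_card_fiber
    (f := (Sum.map Prod.fst (fun _ => ()) : Blocks k → Fin k ⊕ Unit)) (g := Quotient.mk s) σ (by
      rintro (j | u)
      · rw [card_fiber_blocks_inl]
        exact (hrest _ (σ₁.symm j).2).symm
      · rw [card_fiber_blocks_inr]
        exact hc3.symm)
  refine ⟨e, ?_⟩
  ext x y
  obtain ⟨x, rfl⟩ := e.surjective x
  obtain ⟨y, rfl⟩ := e.surjective y
  change _ ↔ blocks k (e.symm (e x)) (e.symm (e y))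
  rw [e.symm_apply_apply, e.symm_apply_apply]
  change _ ↔ Sum.map Prod.fst (fun _ => ()) x = Sum.map Prod.fst (fun _ => ()) y
  rw [← σ.injective.eq_iff, ← he, ← he]
  exact Quotient.eq.symm

end Transport

instance finite_setoid {A : Type} [Finite A] : Finite (Setoid A) :=
  Finite.of_injective (fun (r : Setoid A) (a b : A) => r a b) fun _ _ h =>
    Setoid.ext fun a b => iff_of_eq (congrFun (congrFun h a) b)

/-! ### Main term and error term -/

section Decomposition

variable (C₀ C₁ C₂ : Type*) {A B X Y : Type}

/-- The number of colourings with `m` moved points whose automorphism group has property `P`. -/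
noncomputable def movedCount (A : Type) (m : ℕ) (P : (G : Type) → [Group G] → Prop) : ℕ :=
  Nat.card {M : Colouring C₀ C₁ C₂ A // (moved (orb (autC M))).ncard = m ∧ P (autC M)}

theorem card_rest_mono {Q Q' Y : Type} [Finite Y] [Finite Q] [Finite Q'] (h : 1 ≤ Nat.card C₂)
    (hQ : Nat.card Q ≤ Nat.card Q') : Nat.card (Rest C₁ C₂ Q Y) ≤ Nat.card (Rest C₁ C₂ Q' Y) := by
  simp only [Nat.card_prod, Nat.card_fun]
  have : 1 ≤ Nat.card C₂ ^ Nat.card Y := Nat.one_le_pow _ _ h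
  gcongr

/-- One more class adds 2N free colours, N in each direction; using one direction suffices. -/
theorem card_rest_mul_two_pow_le (h : 2 ≤ Nat.card C₂) (k N : ℕ) :
    Nat.card (Rest C₁ C₂ (Fin k) (Fin N)) * 2 ^ N ≤
      Nat.card (Rest C₁ C₂ (Fin (k + 1)) (Fin N)) := by
  simp only [Nat.card_prod, Nat.card_fun, Nat.card_fin]
  set q := Nat.card C₂
  have h1 : 2 ^ N ≤ q ^ N := Nat.pow_le_pow_left h N
  have h2 : (q ^ k) ^ N ≤ (q ^ (k + 1)) ^ N :=
    Nat.pow_le_pow_left (Nat.pow_le_pow_right (by omega) (by omega)) N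
  calc _ = Nat.card C₁ ^ N * ((q ^ N) ^ N * (((q ^ N) ^ k * 2 ^ N) * (q ^ k) ^ N)) := by ring
    _ ≤ Nat.card C₁ ^ N * ((q ^ N) ^ N * (((q ^ N) ^ k * q ^ N) * (q ^ (k + 1)) ^ N)) := by gcongr
    _ = _ := by rw [← pow_succ (q ^ N) k]

variable [Finite C₀] [Finite C₁] [Finite C₂]

open Classical in
theorem movedCount_eq_sum [Finite A] [Fintype (Setoid A)] (m : ℕ)
    (P : (G : Type) → [Group G] → Prop) :
    movedCount C₀ C₁ C₂ A m P =
      ∑ r : Setoid A with (moved r).ncard = m, orbCount C₀ C₁ C₂ r P := by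
  have h : ∀ r : {r : Setoid A // (moved r).ncard = m}, Finite
      {M : Colouring C₀ C₁ C₂ A // orb (autC M) = r ∧ P (autC M)} := fun r => Subtype.finite
  rw [Finset.sum_subtype (p := fun r : Setoid A => (moved r).ncard = m) _ (by simp)
    (fun r => orbCount C₀ C₁ C₂ r P)]
  unfold orbCount
  rw [← Nat.card_sigma (β := fun r : {r : Setoid A // (moved r).ncard = m} =>
      {M : Colouring C₀ C₁ C₂ A // orb (autC M) = r ∧ P (autC M)})]
  refine Nat.card_congr
    { toFun := fun M => ⟨⟨_, M.2.1⟩, M.1, rfl, M.2.2⟩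
      invFun := fun q => ⟨q.2.1, by rw [q.2.2.1]; exact q.1.2, q.2.2.2⟩
      left_inv := fun M => rfl
      right_inv := ?_ }
  rintro ⟨⟨r, hr⟩, M, h, hM⟩
  dsimp only at h
  subst h
  rfl

variable (k N : ℕ)

/-- The partitions of `Fin (2 * k + 3 + N)` with `k` pairs, a triple, and singletons. -/
def IsGood (r : Setoid (Fin (2 * k + 3 + N))) : Prop :=
  ∃ e : Blocks k ⊕ Fin N ≃ Fin (2 * k + 3 + N), r = (ext (blocks k) (Fin N)).comap e.symm

variable {k N}

theorem IsGood.ncard_moved {r : Setoid (Fin (2 * k + 3 + N))} (hr : IsGood k N r) :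
    (moved r).ncard = 2 * k + 3 := by
  obtain ⟨e, rfl⟩ := hr
  rw [moved_comap, Set.ncard_image_of_injective _ e.injective, moved_ext nontrivial_blocks,
    ← Nat.card_coe_set_eq, Nat.card_range_of_injective Sum.inl_injective]
  simp [mul_comm]

theorem exists_of_not_isGood {r : Setoid (Fin (2 * k + 3 + N))}
    (hr : (moved r).ncard = 2 * k + 3) (hg : ¬ IsGood k N r) :
    ∃ s : Setoid (Fin (2 * k + 3)), Nat.card (Quotient s) ≤ k ∧
      ∃ e : Fin (2 * k + 3) ⊕ Fin N ≃ Fin (2 * k + 3 + N), r = (ext s (Fin N)).comap e.symm := by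
  obtain ⟨s, hs, e, rfl⟩ := exists_ext_of_ncard_moved hr
  refine ⟨s, (card_quotient_le_or_exists_blocks hs).resolve_right ?_, e, rfl⟩
  rintro ⟨e₀, rfl⟩
  apply hg
  refine ⟨(Equiv.sumCongr e₀ (Equiv.refl _)).trans e, ?_⟩
  ext a b
  simp only [Setoid.comap_rel, Equiv.symm_trans_apply]
  rcases e.symm a with x | x <;> rcases e.symm b with y | y <;> simp [Setoid.comap_rel]

theorem orbCount_le_of_not_isGood (hC : 1 ≤ Nat.card C₂) {P : (G : Type) → [Group G] → Prop}
    (hP : IsoInvariant P) {r : Setoid (Fin (2 * k + 3 + N))}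
    (hr : (moved r).ncard = 2 * k + 3) (hg : ¬ IsGood k N r) :
    orbCount C₀ C₁ C₂ r P ≤ Nat.card (Colouring C₀ C₁ C₂ (Fin (2 * k + 3))) *
      Nat.card (Rest C₁ C₂ (Fin k) (Fin N)) := by
  obtain ⟨s, hs, e, rfl⟩ := exists_of_not_isGood hr hg
  rw [orbCount_comap e _ hP]
  refine (orbCount_le_fullCount C₀ C₁ C₂ _ hP).trans ?_
  rw [fullCount_ext C₀ C₁ C₂ s hP]
  refine Nat.mul_le_mul (Nat.card_le_card_of_injective _ Subtype.val_injective) ?_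
  exact card_rest_mono C₁ C₂ hC (by simpa using hs)

/-- The transported partition depends only on s and on the restriction of e to X. This is what makes
the count of partitions polynomial in N. -/
theorem comap_ext_apply {m N : ℕ} {s : Setoid X} (e : X ⊕ Fin N ≃ Fin (m + N))
    {a b : Fin (m + N)} : (ext s (Fin N)).comap e.symm a b ↔
      a = b ∨ ∃ x x', e (.inl x) = a ∧ e (.inl x') = b ∧ s x x' := by
  obtain ⟨a, rfl⟩ := e.surjective a
  obtain ⟨b, rfl⟩ := e.surjective b
  rw [Setoid.comap_rel, e.symm_apply_apply, e.symm_apply_apply]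
  rcases a with x | y <;> rcases b with x' | y' <;> simp
  rintro rfl
  exact s.refl _

theorem card_not_isGood_le :
    Nat.card {r : Setoid (Fin (2 * k + 3 + N)) //
      (moved r).ncard = 2 * k + 3 ∧ ¬ IsGood k N r} ≤
    Nat.card (Setoid (Fin (2 * k + 3))) * (2 * k + 3 + N) ^ (2 * k + 3) := by
  have h : ∀ r : {r : Setoid (Fin (2 * k + 3 + N)) //
      (moved r).ncard = 2 * k + 3 ∧ ¬ IsGood k N r}, ∃ s : Setoid (Fin (2 * k + 3)),
      ∃ e : Fin (2 * k + 3) ⊕ Fin N ≃ Fin (2 * k + 3 + N),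
        r.1 = (ext s (Fin N)).comap e.symm := fun r => by
    obtain ⟨s, -, e, h⟩ := exists_of_not_isGood r.2.1 r.2.2
    exact ⟨s, e, h⟩
  choose s e hse using h
  have := Nat.card_le_card_of_injective (fun r => (s r, fun x => e r (.inl x))) (by
    intro r r' h
    obtain ⟨h1, h2⟩ := Prod.mk.inj h
    apply Subtype.ext
    rw [hse, hse]
    ext a b
    rw [comap_ext_apply, comap_ext_apply, h1]
    simp only [fun x => congrFun h2 x])
  simpa [Nat.card_prod, Nat.card_fun] using this

/-- The number of partitions with `k` pairs, a triple, and `N` singletons. -/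
noncomputable def goodCount (k N : ℕ) : ℕ :=
  Nat.card {r : Setoid (Fin (2 * k + 3 + N)) // IsGood k N r}

theorem goodCount_pos : 1 ≤ goodCount k N := by
  have h : Nat.card (Blocks k ⊕ Fin N) = Nat.card (Fin (2 * k + 3 + N)) := by
    simp [mul_comm]
  obtain ⟨e⟩ := Finite.card_eq.1 h
  have : Nonempty {r : Setoid (Fin (2 * k + 3 + N)) // IsGood k N r} := ⟨⟨_, e, rfl⟩⟩
  exact Nat.card_pos

/-- All good partitions are conjugate and contribute equally; b collects the partitions with at most
k nontrivial classes. -/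
theorem exists_movedCount_eq (hC : 1 ≤ Nat.card C₂) (k N : ℕ)
    {P : (G : Type) → [Group G] → Prop} (hP : IsoInvariant P) :
    ∃ b : ℕ, movedCount C₀ C₁ C₂ (Fin (2 * k + 3 + N)) (2 * k + 3) P =
        goodCount k N * orbCount C₀ C₁ C₂ (ext (blocks k) (Fin N)) P + b ∧
      b ≤ Nat.card (Setoid (Fin (2 * k + 3))) * (2 * k + 3 + N) ^ (2 * k + 3) *
        (Nat.card (Colouring C₀ C₁ C₂ (Fin (2 * k + 3))) *
          Nat.card (Rest C₁ C₂ (Fin k) (Fin N))) := by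
  classical
  let _ : Fintype (Setoid (Fin (2 * k + 3 + N))) := Fintype.ofFinite _
  rw [movedCount_eq_sum, ← Finset.sum_filter_add_sum_filter_not _ (IsGood k N)]
  refine ⟨_, congrArg (· + _) ?_, ?_⟩
  · rw [Finset.filter_filter, Finset.sum_congr rfl
      (g := fun _ => orbCount C₀ C₁ C₂ (ext (blocks k) (Fin N)) P), Finset.sum_const, smul_eq_mul]
    · congr 1
      rw [goodCount, Nat.card_eq_fintype_card, Fintype.card_subtype]
      congr 1
      ext r
      simp only [Finset.mem_filter, Finset.mem_univ, true_and, and_iff_right_iff_imp]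
      exact IsGood.ncard_moved
    · intro r hr
      obtain ⟨e, rfl⟩ := (Finset.mem_filter.1 hr).2.2
      exact orbCount_comap e _ hP
  · rw [Finset.filter_filter]
    refine (Finset.sum_le_card_nsmul _ _ _ fun r hr => orbCount_le_of_not_isGood C₀ C₁ C₂ hC hP
      (Finset.mem_filter.1 hr).2.1 (Finset.mem_filter.1 hr).2.2).trans ?_
    rw [smul_eq_mul]
    refine Nat.mul_le_mul_right _ ?_
    refine le_trans (le_of_eq ?_) card_not_isGood_le
    rw [Nat.card_eq_fintype_card, Fintype.card_subtype]

end Decomposition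

/-! ### Limits of the normalised counts -/

section Limit

variable (C₀ C₁ C₂ : Type*) [Finite C₀] [Finite C₁] [Finite C₂]

theorem tendsto_orbCount_div [Nonempty C₁] (hC : 2 ≤ Nat.card C₂) (k : ℕ)
    {P : (G : Type) → [Group G] → Prop} (hP : IsoInvariant P) :
    Tendsto (fun N : ℕ => (orbCount C₀ C₁ C₂ (ext (blocks k) (Fin N)) P : ℝ) /
      Nat.card (Rest C₁ C₂ (Quotient (blocks k)) (Fin N))) atTop
      (𝓝 (fullCount C₀ C₁ C₂ (blocks k) P)) := by
  have hne : Nonempty C₂ := (Nat.card_pos_iff.1 (by omega)).1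
  have h1 := (tendsto_errCount_div (C₀ := C₀) (C₁ := C₁) hC (blocks k)).const_sub
    (fullCount C₀ C₁ C₂ (blocks k) P : ℝ)
  rw [sub_zero] at h1
  refine tendsto_of_tendsto_of_tendsto_of_le_of_le h1 tendsto_const_nhds (fun N => ?_) fun N => ?_
  all_goals
    have hR : (0 : ℝ) < Nat.card (Rest C₁ C₂ (Quotient (blocks k)) (Fin N)) :=
      Nat.cast_pos.2 Nat.card_pos
  · rw [le_div_iff₀ hR, sub_mul, div_mul_cancel₀ _ hR.ne', sub_le_iff_le_add]
    have := fullCount_le_orbCount_add C₀ C₁ C₂ (Y := Fin N) (blocks k) hP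
    rw [fullCount_ext C₀ C₁ C₂ _ hP] at this
    exact_mod_cast this
  · rw [div_le_iff₀ hR]
    have := orbCount_le_fullCount C₀ C₁ C₂ (ext (blocks k) (Fin N)) hP
    rw [fullCount_ext C₀ C₁ C₂ _ hP] at this
    exact_mod_cast this

theorem tendsto_movedCount_div_goodCount [Nonempty C₁] (hC : 2 ≤ Nat.card C₂) (k : ℕ)
    {P : (G : Type) → [Group G] → Prop} (hP : IsoInvariant P) :
    Tendsto (fun N : ℕ => (movedCount C₀ C₁ C₂ (Fin (2 * k + 3 + N)) (2 * k + 3) P : ℝ) /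
      (goodCount k N * Nat.card (Rest C₁ C₂ (Quotient (blocks k)) (Fin N)))) atTop
      (𝓝 (fullCount C₀ C₁ C₂ (blocks k) P)) := by
  have hne : Nonempty C₂ := (Nat.card_pos_iff.1 (by omega)).1
  choose b hb hb' using fun N => exists_movedCount_eq C₀ C₁ C₂ (by omega) k N hP
  set K : ℝ := (Nat.card (Setoid (Fin (2 * k + 3))) : ℝ) *
    Nat.card (Colouring C₀ C₁ C₂ (Fin (2 * k + 3))) with hK
  have hlim : Tendsto (fun N : ℕ => (b N : ℝ) /
      (goodCount k N * Nat.card (Rest C₁ C₂ (Quotient (blocks k)) (Fin N)))) atTop (𝓝 0) := by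
    have h1 : Tendsto (fun N : ℕ => K * (((2 * k + 3 + N : ℕ) : ℝ) ^ (2 * k + 3) *
        decay (2 * k + 3) N)) atTop (𝓝 0) := by
      have := (tendsto_pow_mul_decay (2 * k + 3) (2 * k + 3)).const_mul K
      rwa [mul_zero] at this
    refine squeeze_zero (fun N => by positivity) (fun N => ?_) h1
    have hR : (0 : ℝ) < Nat.card (Rest C₁ C₂ (Quotient (blocks k)) (Fin N)) :=
      Nat.cast_pos.2 Nat.card_pos
    have hg : (1 : ℝ) ≤ goodCount k N := by exact_mod_cast goodCount_pos
    have h2 : (Nat.card (Rest C₁ C₂ (Fin k) (Fin N)) : ℝ) * 2 ^ N ≤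
        Nat.card (Rest C₁ C₂ (Quotient (blocks k)) (Fin N)) := by
      have h3 := card_rest_mul_two_pow_le C₁ C₂ hC k N
      have h4 := card_rest_mono C₁ C₂ (Q := Fin (k + 1)) (Q' := Quotient (blocks k))
        (Y := Fin N) (by omega) (by rw [card_quotient_blocks, Nat.card_fin])
      exact_mod_cast h3.trans h4
    -- The loss 2^(-N) is smaller than `decay`, so the limit proved for the union bound also
    -- disposes of this error.
    have h5 : 1 ≤ (2 : ℝ) ^ N * decay (2 * k + 3) N := by
      rw [decay, ← Real.rpow_natCast, ← Real.rpow_add two_pos]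
      apply Real.one_le_rpow one_le_two
      have : (N : ℝ) / ((2 * k + 3 : ℕ) + 3) ≤ N := div_le_self (by positivity) (by
        push_cast; nlinarith [(Nat.cast_nonneg k : (0 : ℝ) ≤ k)])
      rw [neg_div]
      linarith
    have hd : 0 < decay (2 * k + 3) N := Real.rpow_pos_of_pos two_pos _
    rw [div_le_iff₀ (by positivity)]
    set R := (Nat.card (Rest C₁ C₂ (Quotient (blocks k)) (Fin N)) : ℝ)
    set R' := (Nat.card (Rest C₁ C₂ (Fin k) (Fin N)) : ℝ)
    set p := ((2 * k + 3 + N : ℕ) : ℝ) ^ (2 * k + 3)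
    set d := decay (2 * k + 3) N
    have h6 : (b N : ℝ) ≤ K * p * R' := by
      have : (b N : ℝ) ≤ _ := Nat.cast_le.2 (hb' N)
      refine this.trans (le_of_eq ?_)
      rw [hK]
      push_cast
      simp only [p, R']
      push_cast
      ring
    have hp : 0 ≤ p := by positivity
    have hK0 : 0 ≤ K := by positivity
    have hR' : 0 ≤ R' := Nat.cast_nonneg _
    have h7 : R' ≤ d * R := by
      calc R' ≤ R' * (2 ^ N * d) := le_mul_of_one_le_right hR' h5
        _ = R' * 2 ^ N * d := by ring
        _ ≤ R * d := by gcongr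
        _ = d * R := mul_comm _ _
    calc (b N : ℝ) ≤ K * p * (d * R) := h6.trans (by gcongr)
      _ ≤ K * p * (d * R) * goodCount k N := le_mul_of_one_le_right (by positivity) hg
      _ = _ := by ring
  have hsum := (tendsto_orbCount_div C₀ C₁ C₂ hC k hP).add hlim
  rw [add_zero] at hsum
  refine hsum.congr fun N => ?_
  have hR : (0 : ℝ) < Nat.card (Rest C₁ C₂ (Quotient (blocks k)) (Fin N)) :=
    Nat.cast_pos.2 Nat.card_pos
  have hg : (0 : ℝ) < goodCount k N := by exact_mod_cast goodCount_pos
  rw [hb]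
  push_cast
  field_simp

/-- The normalising factor does not depend on P and cancels, so neither `goodCount` nor the number
of remaining colours has to be computed. -/
theorem tendsto_movedCount_div [Nonempty C₁] (hC : 2 ≤ Nat.card C₂) (k : ℕ)
    {P : (G : Type) → [Group G] → Prop} (hP : IsoInvariant P)
    (hpos : 0 < fullCount C₀ C₁ C₂ (blocks k) fun _ _ => True) :
    Tendsto (fun n : ℕ => (movedCount C₀ C₁ C₂ (Fin n) (2 * k + 3) P : ℝ) /
      movedCount C₀ C₁ C₂ (Fin n) (2 * k + 3) fun _ _ => True) atTop
      (𝓝 ((fullCount C₀ C₁ C₂ (blocks k) P : ℝ) /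
        fullCount C₀ C₁ C₂ (blocks k) fun _ _ => True)) := by
  have hne : Nonempty C₂ := (Nat.card_pos_iff.1 (by omega)).1
  have h1 := tendsto_movedCount_div_goodCount C₀ C₁ C₂ hC k hP
  have h2 := tendsto_movedCount_div_goodCount C₀ C₁ C₂ hC k (P := fun _ _ => True)
    fun _ _ _ _ _ _ => trivial
  have h3 := h1.div h2 (by exact_mod_cast hpos.ne')
  rw [← tendsto_add_atTop_iff_nat (2 * k + 3)]
  refine h3.congr fun N => ?_
  have hR : (0 : ℝ) < Nat.card (Rest C₁ C₂ (Quotient (blocks k)) (Fin N)) :=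
    Nat.cast_pos.2 Nat.card_pos
  have hg : (0 : ℝ) < goodCount k N := by exact_mod_cast goodCount_pos
  rw [Pi.div_apply, div_div_div_cancel_right₀ (by positivity), add_comm N]

end Limit

/-! ### From relational structures to colourings -/

section Language

variable (L : FirstOrder.Language.{u, v}) {A : Type}

/-- The colouring that encodes a structure. -/
def toColouring (S : L.Structure A) :
    Colouring (L.Relations 0 → Prop) (L.Relations 1 → Prop) (L.Relations 2 → Prop) A :=
  (fun R => S.RelMap R ![], fun x R => S.RelMap R ![x], fun x y R => S.RelMap R ![x, y])

variable {L}

theorem isEmpty_relations (hr : IsGreatest {l : ℕ | Nonempty (L.Relations l)} 2) (n : ℕ) :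
    IsEmpty (L.Relations (n + 3)) := by
  by_contra h
  have := hr.2 (not_isEmpty_iff.1 h)
  omega

theorem toColouring_bijective [L.IsRelational]
    (hr : IsGreatest {l : ℕ | Nonempty (L.Relations l)} 2) :
    Function.Bijective (toColouring L (A := A)) := by
  have hE := isEmpty_relations hr
  constructor
  · intro S S' h
    obtain ⟨h0, h⟩ := Prod.mk.inj h
    obtain ⟨h1, h2⟩ := Prod.mk.inj h
    ext n R v
    · exact isEmptyElim R
    · match n, R, v with
      | 0, R, v =>
        have : v = ![] := Subsingleton.elim _ _
        subst this
        exact iff_of_eq (congrFun h0 R)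
      | 1, R, v =>
        have : v = ![v 0] := by ext i; fin_cases i; rfl
        rw [this]
        exact iff_of_eq (congrFun (congrFun h1 (v 0)) R)
      | 2, R, v =>
        have : v = ![v 0, v 1] := by ext i; fin_cases i <;> rfl
        rw [this]
        exact iff_of_eq (congrFun (congrFun (congrFun h2 (v 0)) (v 1)) R)
      | n + 3, R, v => exact ((hE n).false R).elim
  · rintro ⟨c₀, c₁, c₂⟩
    refine ⟨⟨fun f => isEmptyElim f, fun {n} R v =>
      match n, R, v with
      | 0, R, _ => c₀ R
      | 1, R, v => c₁ (v 0) R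
      | 2, R, v => c₂ (v 0) (v 1) R
      | _ + 3, _, _ => False⟩, rfl⟩

theorem aut_eq_autC [L.IsRelational] (hr : IsGreatest {l : ℕ | Nonempty (L.Relations l)} 2)
    (S : L.Structure A) : Aut S = autC (toColouring L S) := by
  have hE := isEmpty_relations hr
  ext f
  constructor
  · rintro ⟨g, rfl⟩
    refine ⟨fun x => ?_, fun x y => ?_⟩
    · ext R
      have := g.map_rel' R ![x]
      rwa [show g.toEquiv.toFun ∘ ![x] = ![g.toEquiv x] by ext i; fin_cases i; rfl] at this
    · ext R
      have := g.map_rel' R ![x, y]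
      rwa [show g.toEquiv.toFun ∘ ![x, y] = ![g.toEquiv x, g.toEquiv y] by
        ext i; fin_cases i <;> rfl] at this
  · rintro ⟨h1, h2⟩
    refine ⟨⟨f, fun {n} F => isEmptyElim F, fun {n} R v => ?_⟩, rfl⟩
    match n, R, v with
    | 0, R, v =>
      rw [show f.toFun ∘ v = v from Subsingleton.elim _ _]
    | 1, R, v =>
      have h := iff_of_eq (congrFun (h1 (v 0)) R)
      simp only [toColouring] at h
      rwa [show f.toFun ∘ v = ![f (v 0)] by ext i; fin_cases i; rfl,
        show v = ![v 0] by ext i; fin_cases i; rfl]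
    | 2, R, v =>
      have h := iff_of_eq (congrFun (h2 (v 0) (v 1)) R)
      simp only [toColouring] at h
      rwa [show f.toFun ∘ v = ![f (v 0), f (v 1)] by ext i; fin_cases i <;> rfl,
        show v = ![v 0, v 1] by ext i; fin_cases i <;> rfl]
    | n + 3, R, v => exact ((hE n).false R).elim

theorem sptStar_eq_ncard_moved (S : L.Structure A) : sptStar S = (moved (orb (Aut S))).ncard := by
  unfold sptStar
  congr 1
  ext a
  constructor
  · rintro ⟨f, hf, g, hg, h⟩
    -- The group generated by one automorphism stays inside the automorphism group, so passing to it
    -- moves no new points.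
    have hg' : g ∈ Aut S :=
      (Subgroup.closure_le (Aut S)).2 (Set.singleton_subset_iff.2 hf) hg
    exact ⟨g a, h, g, hg', rfl⟩
  · rintro ⟨b, hb, f, hf, rfl⟩
    exact ⟨f, hf, f, Subgroup.subset_closure rfl, hb⟩

theorem ncard_eq_movedCount [L.IsRelational]
    (hr : IsGreatest {l : ℕ | Nonempty (L.Relations l)} 2) (m n : ℕ)
    (P : (G : Type) → [Group G] → Prop) :
    {S ∈ structuresSptStarEq L m n | P (Aut S)}.ncard =
      movedCount (L.Relations 0 → Prop) (L.Relations 1 → Prop) (L.Relations 2 → Prop)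
        (Fin n) m P := by
  rw [← Nat.card_coe_set_eq]
  refine Nat.card_congr ((Equiv.ofBijective _ (toColouring_bijective hr)).subtypeEquiv fun S => ?_)
  change sptStar S = m ∧ P (Aut S) ↔ (moved (orb (autC (toColouring L S)))).ncard = m ∧
    P (autC (toColouring L S))
  rw [sptStar_eq_ncard_moved, aut_eq_autC hr]

variable (L) in
/-- The number of full colourings of `k` pairs and a triple for a language. -/
noncomputable abbrev blockCount (k : ℕ) (P : (G : Type) → [Group G] → Prop) : ℕ :=
  fullCount (L.Relations 0 → Prop) (L.Relations 1 → Prop) (L.Relations 2 → Prop) (blocks k) P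

theorem finite_relations [Finite (Σ l : ℕ, L.Relations l)] (l : ℕ) : Finite (L.Relations l) :=
  Finite.of_injective (fun R => (⟨l, R⟩ : Σ l : ℕ, L.Relations l)) sigma_mk_injective

theorem fullCount_pos {C₀ C₁ C₂ : Type*} [Finite C₀] [Finite C₁] [Finite C₂] {k : ℕ}
    {P : (G : Type) → [Group G] → Prop} {N : Colouring C₀ C₁ C₂ (Blocks k)}
    (hN : Full (blocks k) N) (hP : P (autC N ⊓ blockStab (blocks k) : Subgroup _)) :
    0 < fullCount C₀ C₁ C₂ (blocks k) P := by
  have : Nonempty {M : Colouring C₀ C₁ C₂ (Blocks k) // Full (blocks k) M ∧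
    P (autC M ⊓ blockStab (blocks k) : Subgroup _)} := ⟨⟨N, hN, hP⟩⟩
  exact Nat.card_pos

theorem fullCount_lt {C₀ C₁ C₂ : Type*} [Finite C₀] [Finite C₁] [Finite C₂] {k : ℕ}
    {P : (G : Type) → [Group G] → Prop} {N : Colouring C₀ C₁ C₂ (Blocks k)}
    (hN : Full (blocks k) N) (hP : ¬ P (autC N ⊓ blockStab (blocks k) : Subgroup _)) :
    fullCount C₀ C₁ C₂ (blocks k) P < fullCount C₀ C₁ C₂ (blocks k) fun _ _ => True := by
  have := Fintype.ofFinite {M : Colouring C₀ C₁ C₂ (Blocks k) // Full (blocks k) M ∧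
    P (autC M ⊓ blockStab (blocks k) : Subgroup _)}
  have := Fintype.ofFinite {M : Colouring C₀ C₁ C₂ (Blocks k) // Full (blocks k) M ∧ True}
  rw [fullCount, fullCount, Nat.card_eq_fintype_card, Nat.card_eq_fintype_card]
  refine Fintype.card_lt_of_injective_of_notMem
    (fun M => ⟨M.1, M.2.1, trivial⟩) (fun M M' h => ?_) (b := ⟨N, hN, trivial⟩) ?_
  · simpa [Subtype.ext_iff] using h
  · rintro ⟨M, h⟩
    have : M.1 = N := Subtype.ext_iff.1 h
    subst this
    exact hP M.2.2

theorem exists_ne_colours (hr : IsGreatest {l : ℕ | Nonempty (L.Relations l)} 2) :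
    ∃ α β : L.Relations 2 → Prop, α ≠ β := by
  obtain ⟨R⟩ := hr.1
  exact ⟨fun _ => True, fun _ => False, fun h => by simpa using congrFun h R⟩

theorem autIso_congr {A : Type} {S : L.Structure A} {G H : Type} [Group G] [Group H]
    (e : G ≃* H) : AutIso S G ↔ AutIso S H :=
  ⟨fun ⟨f⟩ => ⟨f.trans e⟩, fun ⟨f⟩ => ⟨f.trans e.symm⟩⟩

theorem HasRationalLimitProportion.congr {K : (n : ℕ) → Set (L.Structure (Fin n))}
    {G H : Type} [Group G] [Group H] (e : G ≃* H) (h : HasRationalLimitProportion K G) :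
    HasRationalLimitProportion K H := by
  unfold HasRationalLimitProportion at h ⊢
  simpa only [autIso_congr e] using h

variable [L.IsRelational] [Finite (Σ l : ℕ, L.Relations l)]

theorem tendsto_proportion (hr : IsGreatest {l : ℕ | Nonempty (L.Relations l)} 2) (k : ℕ)
    {P : (G : Type) → [Group G] → Prop} (hP : IsoInvariant P) :
    Tendsto (proportion (structuresSptStarEq L (2 * k + 3)) fun _ S => P (Aut S)) atTop
      (𝓝 ((blockCount L k P : ℝ) / blockCount L k fun _ _ => True)) := by
  have := finite_relations (L := L)
  obtain ⟨α, β, hαβ⟩ := exists_ne_colours hr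
  have : Nontrivial (L.Relations 2 → Prop) := ⟨α, β, hαβ⟩
  have hC : 2 ≤ Nat.card (L.Relations 2 → Prop) := Finite.one_lt_card
  obtain ⟨N, hN, -⟩ := exists_full_Sym3 (C₀ := L.Relations 0 → Prop)
    (C₁ := L.Relations 1 → Prop) hαβ le_rfl (id : 1 ≤ k → 1 ≤ k)
  refine (tendsto_movedCount_div _ _ _ hC k hP (fullCount_pos hN trivial)).congr fun n => ?_
  rw [proportion, ← ncard_eq_movedCount hr, ← ncard_eq_movedCount hr]
  simp

theorem isoInvariant_nonempty_mulEquiv (G : Type) [Group G] :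
    IsoInvariant fun H _ => Nonempty (H ≃* G) :=
  fun _ _ _ _ ⟨e⟩ ⟨f⟩ => ⟨e.symm.trans f⟩

/-- N makes the limit positive; N', whose group is not G, keeps it below 1. -/
theorem hasRationalLimitProportion (hr : IsGreatest {l : ℕ | Nonempty (L.Relations l)} 2)
    {k : ℕ} {G : Type} [Group G]
    {N N' : Colouring (L.Relations 0 → Prop) (L.Relations 1 → Prop) (L.Relations 2 → Prop)
      (Blocks k)}
    (hN : Full (blocks k) N)
    (hG : Nonempty ((autC N ⊓ blockStab (blocks k) : Subgroup _) ≃* G))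
    (hN' : Full (blocks k) N')
    (hG' : ¬ Nonempty ((autC N' ⊓ blockStab (blocks k) : Subgroup _) ≃* G)) :
    HasRationalLimitProportion (structuresSptStarEq L (2 * k + 3)) G := by
  have := finite_relations (L := L)
  have hpos := fullCount_pos (P := fun H _ => Nonempty (H ≃* G)) hN hG
  have hlt := fullCount_lt (P := fun H _ => Nonempty (H ≃* G)) hN' hG'
  refine ⟨(blockCount L k (fun H _ => Nonempty (H ≃* G)) : ℚ) / blockCount L k fun _ _ => True,
    ?_, ?_, ?_⟩
  · exact div_pos (Nat.cast_pos.2 hpos) (Nat.cast_pos.2 (hpos.trans hlt))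
  · rw [div_lt_one (Nat.cast_pos.2 (hpos.trans hlt))]
    exact Nat.cast_lt.2 hlt
  · have := tendsto_proportion hr k (isoInvariant_nonempty_mulEquiv G)
    push_cast
    exact this

/-- Each of the two groups serves as the other's counterexample, so both limits are below 1 even
when only one t is possible. -/
theorem hasRationalLimitProportion_pow (hr : IsGreatest {l : ℕ | Nonempty (L.Relations l)} 2)
    {k t : ℕ} (h : t ≤ k) (h' : 1 ≤ k → 1 ≤ t) :
    HasRationalLimitProportion (structuresSptStarEq L (2 * k + 3)) ((Fin t → Z 2) × Z 3) ∧
      HasRationalLimitProportion (structuresSptStarEq L (2 * k + 3)) ((Fin t → Z 2) × Sym3) := by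
  obtain ⟨α, β, hαβ⟩ := exists_ne_colours hr
  obtain ⟨N, hN, ⟨e⟩⟩ := exists_full_Z3 (C₀ := L.Relations 0 → Prop)
    (C₁ := L.Relations 1 → Prop) hαβ h h'
  obtain ⟨N', hN', ⟨e'⟩⟩ := exists_full_Sym3 (C₀ := L.Relations 0 → Prop)
    (C₁ := L.Relations 1 → Prop) hαβ h h'
  refine ⟨hasRationalLimitProportion hr hN ⟨e⟩ hN' ?_,
    hasRationalLimitProportion hr hN' ⟨e'⟩ hN ?_⟩
  · rintro ⟨f⟩
    exact not_nonempty_mulEquiv_Z3_Sym3 t t ⟨f.symm.trans e'⟩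
  · rintro ⟨f⟩
    exact not_nonempty_mulEquiv_Z3_Sym3 t t ⟨e.symm.trans f⟩

theorem almostAll_of_full (hr : IsGreatest {l : ℕ | Nonempty (L.Relations l)} 2) {k : ℕ}
    {P : (G : Type) → [Group G] → Prop} (hP : IsoInvariant P)
    (h : ∀ N : Colouring (L.Relations 0 → Prop) (L.Relations 1 → Prop) (L.Relations 2 → Prop)
      (Blocks k), Full (blocks k) N → P (autC N ⊓ blockStab (blocks k) : Subgroup _)) :
    AlmostAll (structuresSptStarEq L (2 * k + 3)) fun _ S => P (Aut S) := by
  have := finite_relations (L := L)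
  obtain ⟨α, β, hαβ⟩ := exists_ne_colours hr
  obtain ⟨N, hN, -⟩ := exists_full_Sym3 (C₀ := L.Relations 0 → Prop)
    (C₁ := L.Relations 1 → Prop) hαβ le_rfl (id : 1 ≤ k → 1 ≤ k)
  have hpos : 0 < blockCount L k fun _ _ => True := fullCount_pos hN trivial
  have heq : blockCount L k P = blockCount L k fun _ _ => True :=
    Nat.card_congr (Equiv.subtypeEquivRight fun M =>
      ⟨fun hM => ⟨hM.1, trivial⟩, fun hM => ⟨hM.1, h M hM.1⟩⟩)
  have := tendsto_proportion hr k hP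
  rwa [heq, div_self (Nat.cast_pos.2 hpos).ne'] at this

theorem almostAll_autIso (hr : IsGreatest {l : ℕ | Nonempty (L.Relations l)} 2) (k : ℕ) :
    AlmostAll (structuresSptStarEq L (2 * k + 3)) fun _ S =>
      ∃ t : ℕ, t ≤ k ∧ (1 ≤ k → 1 ≤ t) ∧
        (AutIso S ((Fin t → Z 2) × Z 3) ∨ AutIso S ((Fin t → Z 2) × Sym3)) := by
  refine almostAll_of_full hr (P := fun G _ => ∃ t : ℕ, t ≤ k ∧ (1 ≤ k → 1 ≤ t) ∧
      (Nonempty (G ≃* (Fin t → Z 2) × Z 3) ∨ Nonempty (G ≃* (Fin t → Z 2) × Sym3))) ?_ ?_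
  · rintro G H _ _ ⟨e⟩ ⟨t, h, h', hG⟩
    refine ⟨t, h, h', hG.imp ?_ ?_⟩
    · rintro ⟨f⟩
      exact ⟨e.symm.trans f⟩
    · rintro ⟨f⟩
      exact ⟨e.symm.trans f⟩
  · exact fun N hN => exists_mulEquiv_of_full hN

end Language

end TypicalAut

theorem mainTheorem4 (L : FirstOrder.Language.{u, v}) [L.IsRelational]
    [Finite (Σ l : ℕ, L.Relations l)]
    (hr : IsGreatest {l : ℕ | Nonempty (L.Relations l)} 2) :
    (TypicalAut.AlmostAll (TypicalAut.structuresSptStarEq L 3)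
        (fun _ S => TypicalAut.AutIso S (TypicalAut.Z 3) ∨ TypicalAut.AutIso S TypicalAut.Sym3) ∧
      TypicalAut.HasRationalLimitProportion (TypicalAut.structuresSptStarEq L 3)
        (TypicalAut.Z 3) ∧
      TypicalAut.HasRationalLimitProportion (TypicalAut.structuresSptStarEq L 3)
        TypicalAut.Sym3) ∧
    (∀ i : ℕ, 1 < i →
      TypicalAut.AlmostAll (TypicalAut.structuresSptStarEq L (2 * i + 1))
        (fun _ S => ∃ t : ℕ, 1 ≤ t ∧ t ≤ i - 1 ∧
          (TypicalAut.AutIso S ((Fin t → TypicalAut.Z 2) × TypicalAut.Z 3) ∨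
            TypicalAut.AutIso S ((Fin t → TypicalAut.Z 2) × TypicalAut.Sym3))) ∧
      ∀ t : ℕ, 1 ≤ t → t ≤ i - 1 →
        TypicalAut.HasRationalLimitProportion (TypicalAut.structuresSptStarEq L (2 * i + 1))
          ((Fin t → TypicalAut.Z 2) × TypicalAut.Z 3) ∧
        TypicalAut.HasRationalLimitProportion (TypicalAut.structuresSptStarEq L (2 * i + 1))
          ((Fin t → TypicalAut.Z 2) × TypicalAut.Sym3)) := by
  have e₁ : (Fin 0 → TypicalAut.Z 2) × TypicalAut.Z 3 ≃* TypicalAut.Z 3 := MulEquiv.uniqueProd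
  have e₂ : (Fin 0 → TypicalAut.Z 2) × TypicalAut.Sym3 ≃* TypicalAut.Sym3 :=
    MulEquiv.uniqueProd
  refine ⟨⟨?_, ?_, ?_⟩, ?_⟩
  -- With k = 0 there are no pairs, so t = 0 and the factor of 2-power order is trivial.
  · have h := TypicalAut.almostAll_autIso hr 0
    have h0 : ∀ t : ℕ, t ≤ 0 ∧ (1 ≤ 0 → 1 ≤ t) ↔ t = 0 := fun t => by omega
    simpa only [← and_assoc, h0, exists_eq_left, TypicalAut.autIso_congr e₁,
      TypicalAut.autIso_congr e₂] using h
  · exact (TypicalAut.hasRationalLimitProportion_pow hr (k := 0) le_rfl id).1.congr e₁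
  · exact (TypicalAut.hasRationalLimitProportion_pow hr (k := 0) le_rfl id).2.congr e₂
  · intro i hi
    obtain ⟨k, rfl⟩ : ∃ k, i = k + 1 := ⟨i - 1, by omega⟩
    rw [show 2 * (k + 1) + 1 = 2 * k + 3 by ring, Nat.add_sub_cancel]
    refine ⟨?_, fun t ht htk => TypicalAut.hasRationalLimitProportion_pow hr htk fun _ => ht⟩
    have h := TypicalAut.almostAll_autIso hr k
    have h0 : ∀ t : ℕ, t ≤ k ∧ (1 ≤ k → 1 ≤ t) ↔ 1 ≤ t ∧ t ≤ k := fun t => by omega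
    simpa only [← and_assoc, h0] using h
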